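/- **Setting.** A *cell* is given by $L,a,r>0$ and a bounded closed domain $\Gamma_{\rm box}\subset[0,L]\times\mathbb R$ (the closure of its connected interior) such that: (1) $\partial\Gamma_{\rm box}=\partial\Gamma_{\rm L}\cup\partial\Gamma_{\rm R}\cup\bigcup_{k=1}^b\partial\Gamma_k$ with openings $\partial\Gamma_{\rm L}=\{0\}\times[-a,a]$, $\partial\Gamma_{\rm R}=\{L\}\times[-a,a]$ and arcs of circle $\partial\Gamma_k$ that are dispersing (near each non-corner point of $\partial\Gamma_k$, $\Gamma_{\rm box}$ is the exterior of the circle; the corners are the end points of arcs and openings); (2) the closed disk $D$ of centre $c=(L/2,0)$ and radius $r$ lies in the interior of $\Gamma_{\rm box}$; (3) for every $z\in\partial\Gamma_{\rm box}$, $[c,z]\cap\partial\Gamma_{\rm box}=\{z\}$. Let $I_k\subset\partial D$ be the largest open set of points $\theta$ from which a particle can return to $\theta$ after flying freely to a non-corner point of $\partial\Gamma_k$, being reflected specularly there, and flying freely back. The cell is *1-controllable* if $\bigcup_kI_k=\partial D$. The *system* consists of $N$ identical cells $\Gamma^{(1)},\dots,\Gamma^{(N)}$ placed side by side, consecutive ones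 being joined through their openings, each with a disk $D^{(\ell)}$ that is fixed in place but rotates with (clockwise) angular velocity $\omega_\ell$. Finitely many particles, which do not interact directly, move on straight lines at constant velocity inside the cells and outside the disks. They are reflected specularly on the arcs, pass freely through inner openings, and leave the system when they reach $\partial\Gamma^{(1)}_{\rm L}$ or $\partial\Gamma^{(N)}_{\rm R}$. When a particle with normal and tangential (clockwise) velocity components $v^{\rm n},v^{\rm t}$ hits a disk of angular velocity $\omega$, then $(v^{\rm n})'=-v^{\rm n}$, $(v^{\rm t})'=\omega$, $\omega'=v^{\rm t}$; otherwise angular velocities are constant. Only motions without collisions with corners, tangent collisions with a disk, or simultaneous collisions of several particles with the same disk are considered. Particles can be injected through $\partial\Gamma^{(1)}_{\rm L}$ and $\partial\Gamma^{(N)}_{\rm R}$ at any times with any velocities pointing into the system; injected particles are called *drivers*. **Proposition.** Assume that the cells are 1-controllable, that at time $0$ the disks rotate with angular velocities $\hat\omega_1,\dots,\hat\omega_N$, and that (when nothing is injected) none of the particles which are inside the system collides with any disk before time $\tau>0$. Then, given $j\in\{1,\dots,N\}$, $\omega_j\in\mathbb R$ and $0<\delta<\tau$, there is a way to inject finitely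 many drivers through $\partial\Gamma^{(1)}_{\rm L}$, at times in $[0,\delta)$, and nothing else, such that at time $\delta$ disk $j$ has angular velocity $\omega_j$, every disk $\ell\neq j$ has angular velocity $\hat\omega_\ell$, and all the drivers have left the system through $\partial\Gamma^{(1)}_{\rm L}$. The same holds with $\partial\Gamma^{(N)}_{\rm R}$ in place of $\partial\Gamma^{(1)}_{\rm L}$. -/

import Mathlib

open Filter Topology

noncomputable section

/-! The plane is `ℂ` (with its real inner product), a point `(x, y)` being `x + i y`. -/

/-- A closed, nondegenerate arc of a circle: the points of the circle whose polar angle about the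
centre lies in `[lo, hi]`. -/
structure CircArc where
  center : ℂ
  radius : ℝ
  lo : ℝ
  hi : ℝ
  radius_pos : 0 < radius
  lo_lt_hi : lo < hi
  hi_lt : hi < lo + 2 * Real.pi

/-- The point of the circle of centre `c` and radius `ρ` at polar angle `t`. -/
def circlePt (c : ℂ) (ρ t : ℝ) : ℂ := c + ((ρ : ℂ) * ⟨Real.cos t, Real.sin t⟩)

/-- The points of the arc. -/
def CircArc.carrier (A : CircArc) : Set ℂ :=
  circlePt A.center A.radius '' Set.Icc A.lo A.hi

/-- The two end points of the arc. -/
def CircArc.ends (A : CircArc) : Set ℂ :=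
  {circlePt A.center A.radius A.lo, circlePt A.center A.radius A.hi}

/-- The vertical segment `{(x, y) : -a ≤ y ≤ a}`. -/
def vertSeg (x a : ℝ) : Set ℂ := {p | p.re = x ∧ |p.im| ≤ a}

/-- Specular reflection of the velocity `v` at a boundary point with (not necessarily unit)
normal vector `n`: the normal component changes sign, the tangential one is kept. -/
def specular (n v : ℂ) : ℂ := v - (2 * inner ℝ n v / ‖n‖ ^ 2) • n

/-- The data describing a cell: the set `box`, its width, the half size of the openings, the radius
of the disk and the arcs that make up the rest of the boundary. -/
structure CellShape where
  box : Set ℂ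
  width : ℝ
  halfOpening : ℝ
  diskRadius : ℝ
  numArcs : ℕ
  arc : Fin numArcs → CircArc

namespace CellShape

variable (C : CellShape)

/-- The centre `(L/2, 0)` of the disk. -/
def diskCenter : ℂ := ((C.width / 2 : ℝ) : ℂ)

/-- The corner points: the end points of the arcs and of the two openings. -/
def corners : Set ℂ :=
  (⋃ k, (C.arc k).ends) ∪
    {⟨0, C.halfOpening⟩, ⟨0, -C.halfOpening⟩,
      ⟨C.width, C.halfOpening⟩, ⟨C.width, -C.halfOpening⟩}

/-- The closed region accessible to particles: the box without the open disk. -/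
def region : Set ℂ := C.box \ Metric.ball C.diskCenter C.diskRadius

/-- The interior of `region`. -/
def openRegion : Set ℂ := interior C.box \ Metric.closedBall C.diskCenter C.diskRadius

/-- The geometric conditions on a cell. -/
structure IsCell : Prop where
  halfOpening_pos : 0 < C.halfOpening
  diskRadius_pos : 0 < C.diskRadius
  /-- `box` is a bounded closed domain. -/
  isConnected : IsConnected (interior C.box)
  closure_interior : closure (interior C.box) = C.box
  isBounded : Bornology.IsBounded C.box
  width_spec : ∀ p ∈ C.box, p.re ∈ Set.Icc 0 C.width
  /-- The boundary consists of the two openings and of the arcs. -/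
  frontier_eq : frontier C.box =
    vertSeg 0 C.halfOpening ∪ vertSeg C.width C.halfOpening ∪ ⋃ k, (C.arc k).carrier
  /-- The arcs are dispersing: near each of its non-corner points, the box is the exterior of the
  circle. -/
  dispersing : ∀ k, ∀ z ∈ (C.arc k).carrier, z ∉ C.corners →
    ∀ᶠ p in 𝓝 z, (p ∈ C.box ↔ (C.arc k).radius ≤ dist p (C.arc k).center)
  /-- The closed disk lies in the interior of the box. -/
  disk_subset : Metric.closedBall C.diskCenter C.diskRadius ⊆ interior C.box
  /-- Every ray from the centre of the disk meets the boundary of the box only once. -/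
  star : ∀ z ∈ frontier C.box, segment ℝ C.diskCenter z ∩ frontier C.box = {z}

/-- The point of the rim of the disk at angle `θ`. -/
def rimPt (θ : ℝ) : ℂ := circlePt C.diskCenter C.diskRadius θ

/-- The return map through the `k`-th arc: a particle that leaves the rim at `θ` in a suitable
direction flies freely to a non-corner point `z` of arc `k`, is reflected specularly there, and
flies freely to the rim point `θ'`. -/
def ReturnsVia (k : Fin C.numArcs) (θ θ' : ℝ) : Prop :=
  ∃ z ∈ (C.arc k).carrier, z ∉ C.corners ∧
    openSegment ℝ (C.rimPt θ) z ⊆ C.openRegion ∧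
    openSegment ℝ z (C.rimPt θ') ⊆ C.openRegion ∧
    ∃ s : ℝ, 0 < s ∧
      C.rimPt θ' - z = s • specular (z - (C.arc k).center) (z - C.rimPt θ)

/-- The illuminated segment of arc `k` (as a set of angles): the largest open set of angles from
which a particle can return to its starting point by one reflection on arc `k`. -/
def illuminated (k : Fin C.numArcs) : Set ℝ := interior {θ | C.ReturnsVia k θ θ}

/-- A cell is 1-controllable if the illuminated segments cover the whole rim of the disk. -/
def OneControllable : Prop := ∀ θ : ℝ, ∃ k, θ ∈ C.illuminated k

/-! ### The chain of `N` copies of the cell, copy `ℓ` being translated by `ℓ * width` -/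

/-- The coordinates of the point `p` relative to cell `ℓ`. -/
def loc (ℓ : ℕ) (p : ℂ) : ℂ := p - (((ℓ : ℝ) * C.width : ℝ) : ℂ)

/-- The closed region accessible to the particles in the chain. -/
def chain (N : ℕ) : Set ℂ := {p | ∃ ℓ : Fin N, C.loc ℓ p ∈ C.region}

/-- `p` lies on the rim of disk `ℓ`. -/
def OnDisk (ℓ : ℕ) (p : ℂ) : Prop := dist (C.loc ℓ p) C.diskCenter = C.diskRadius

/-- `p` lies on arc `k` of cell `ℓ`. -/
def OnWall (ℓ : ℕ) (k : Fin C.numArcs) (p : ℂ) : Prop := C.loc ℓ p ∈ (C.arc k).carrier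

/-- `p` is a corner point of cell `ℓ`. -/
def OnCorner (ℓ : ℕ) (p : ℂ) : Prop := C.loc ℓ p ∈ C.corners

/-- The unit normal to disk `ℓ` at a point `p` of its rim. -/
def diskNormal (ℓ : ℕ) (p : ℂ) : ℂ := (C.diskRadius)⁻¹ • (C.loc ℓ p - C.diskCenter)

/-- The unit tangent to disk `ℓ` at a point `p` of its rim, in the clockwise direction. -/
def diskTangent (ℓ : ℕ) (p : ℂ) : ℂ := -Complex.I * C.diskNormal ℓ p

end CellShape

/-- The two ends of the chain, at which the heat baths are located. -/
inductive Side where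
  | left
  | right

/-- The opening of the chain of `N` cells towards the bath on a given side. -/
def CellShape.bath (C : CellShape) (N : ℕ) : Side → Set ℂ
  | Side.left => vertSeg 0 C.halfOpening
  | Side.right => vertSeg ((N : ℝ) * C.width) C.halfOpening

/-- The velocity `v` points into the chain at the opening on the given side. -/
def Side.Inward : Side → ℂ → Prop
  | Side.left, v => 0 < v.re
  | Side.right, v => v.re < 0

/-- A state of the chain of `N` cells with `n` particles: positions and velocities of the particles,
angular positions and (clockwise) angular velocities of the disks. -/
structure ChainState (N n : ℕ) where
  pos : Fin n → ℂ
  vel : Fin n → ℂ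
  angle : Fin N → Real.Angle
  spin : Fin N → ℝ

/-- A realization of the injection process with `m` injected particles: injection times, points and
velocities. -/
structure Injection (m : ℕ) where
  time : Fin m → ℝ
  pos : Fin m → ℂ
  vel : Fin m → ℂ

/-- No particle is injected. -/
def Injection.none : Injection 0 := ⟨Fin.elim0, Fin.elim0, Fin.elim0⟩

/-- All particles are injected through the opening on side `S` (not at its end points), with
velocities pointing into the chain. -/
def Injection.IsFrom {m : ℕ} (I : Injection m) (C : CellShape) (N : ℕ) (S : Side) : Prop :=
  ∀ i, I.pos i ∈ C.bath N S ∧ |(I.pos i).im| < C.halfOpening ∧ S.Inward (I.vel i)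

/-- The time at which a particle begins to take part in the motion: time `0` for the `n` particles
of the initial state, the injection time for the injected ones. -/
def enterTime (n : ℕ) {m : ℕ} (I : Injection m) : Fin n ⊕ Fin m → ℝ :=
  Sum.elim (fun _ => 0) I.time

/-- The evolution, during the time interval `[0, T)`, of the chain of `N` cells which is in the state
`ξ` at time `0` and into which particles are injected according to `I`.
Particle `p` is in the system from `enterTime n I p` until `exitTime p`; its position and velocity
outside this period are meaningless (and `exitTime p ≥ T` means that it does not leave before `T`).
Velocities and angular velocities are right-continuous: at a collision time they are the values after
the collision. Collisions with corners, tangent collisions with a disk, and simultaneous collisions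
of several particles with the same disk are excluded. -/
structure Evolution (C : CellShape) (N : ℕ) {n m : ℕ} (ξ : ChainState N n) (I : Injection m)
    (T : ℝ) where
  pos : Fin n ⊕ Fin m → ℝ → ℂ
  vel : Fin n ⊕ Fin m → ℝ → ℂ
  exitTime : Fin n ⊕ Fin m → ℝ
  angle : Fin N → ℝ → Real.Angle
  spin : Fin N → ℝ → ℝ
  enter_lt_exit : ∀ p, enterTime n I p < exitTime p
  /-- Initial and injection data. -/
  pos_enter : ∀ p, pos p (enterTime n I p) = Sum.elim ξ.pos I.pos p
  vel_enter : ∀ p, vel p (enterTime n I p) = Sum.elim ξ.vel I.vel p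
  spin_zero : ∀ ℓ, spin ℓ 0 = ξ.spin ℓ
  /-- The disks turn with their angular velocities. -/
  angle_eq : ∀ ℓ, ∀ t, 0 ≤ t → t < T →
    angle ℓ t = ξ.angle ℓ + ((∫ u in (0 : ℝ)..t, spin ℓ u : ℝ) : Real.Angle)
  /-- Particles stay in the accessible region, -/
  pos_mem : ∀ p t, enterTime n I p ≤ t → t < exitTime p → t < T → pos p t ∈ C.chain N
  /-- they never hit a corner, -/
  not_corner : ∀ p t, enterTime n I p < t → t ≤ exitTime p → t < T →
    ∀ ℓ : Fin N, ¬ C.OnCorner ℓ (pos p t)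
  /-- and they leave the system as soon as they reach an opening towards a bath. -/
  not_bath : ∀ p t, enterTime n I p < t → t < exitTime p → t < T → ∀ S, pos p t ∉ C.bath N S
  exit_bath : ∀ p, exitTime p < T → ∃ S, pos p (exitTime p) ∈ C.bath N S
  /-- Just after each time, particles move on straight lines at constant velocity and the disks
  turn at constant angular velocity. -/
  move_right : ∀ p t, enterTime n I p ≤ t → t < exitTime p → t < T →
    ∀ᶠ t' in 𝓝[>] t, pos p t' = pos p t + (t' - t) • vel p t ∧ vel p t' = vel p t
  spin_right : ∀ ℓ t, 0 ≤ t → t < T → ∀ᶠ t' in 𝓝[>] t, spin ℓ t' = spin ℓ t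
  /-- The same just before each time, with velocities `velPre` and angular velocities `spinPre`. -/
  velPre : Fin n ⊕ Fin m → ℝ → ℂ
  spinPre : Fin N → ℝ → ℝ
  move_left : ∀ p t, enterTime n I p < t → t ≤ exitTime p → t < T →
    ∀ᶠ t' in 𝓝[<] t, pos p t' = pos p t + (t' - t) • velPre p t ∧ vel p t' = velPre p t
  spin_left : ∀ ℓ t, 0 < t → t < T → ∀ᶠ t' in 𝓝[<] t, spin ℓ t' = spinPre ℓ t
  /-- No change of velocity away from the walls and the disks. -/
  free : ∀ p t, enterTime n I p < t → t < exitTime p → t < T →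
    (∀ ℓ : Fin N, (∀ k, ¬ C.OnWall ℓ k (pos p t)) ∧ ¬ C.OnDisk ℓ (pos p t)) →
    vel p t = velPre p t
  /-- Specular reflection on the walls. -/
  wall : ∀ p t, enterTime n I p < t → t < exitTime p → t < T →
    ∀ (ℓ : Fin N) (k : Fin C.numArcs), C.OnWall ℓ k (pos p t) →
    vel p t = specular (C.loc ℓ (pos p t) - (C.arc k).center) (velPre p t)
  /-- Collision with a disk: the normal velocity is reversed, the tangential velocity and the
  angular velocity of the disk are exchanged. -/
  disk : ∀ p t, enterTime n I p < t → t < exitTime p → t < T →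
    ∀ ℓ : Fin N, C.OnDisk ℓ (pos p t) →
    inner ℝ (C.diskNormal ℓ (pos p t)) (velPre p t) ≠ 0 ∧
    vel p t = -(inner ℝ (C.diskNormal ℓ (pos p t)) (velPre p t)) • C.diskNormal ℓ (pos p t)
      + spinPre ℓ t • C.diskTangent ℓ (pos p t) ∧
    spin ℓ t = inner ℝ (C.diskTangent ℓ (pos p t)) (velPre p t)
  /-- The angular velocity of a disk changes only by collisions with particles. -/
  spin_free : ∀ (ℓ : Fin N) (t : ℝ), 0 < t → t < T →
    (∀ p, enterTime n I p < t → t < exitTime p → ¬ C.OnDisk ℓ (pos p t)) → spin ℓ t = spinPre ℓ t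
  /-- At most one particle collides with a given disk at a given time. -/
  not_simultaneous : ∀ p p' t, enterTime n I p < t → t < exitTime p → enterTime n I p' < t →
    t < exitTime p' → t < T →
    ∀ ℓ : Fin N, C.OnDisk ℓ (pos p t) → C.OnDisk ℓ (pos p' t) → p = p'

end

/-!
The proof is an induction on the depth of the disk, counted from the bath on side `S`. Call the disks
at depth less than `d` *settable* (`Settable`) if, in any time window however short, drivers that
enter and leave within the window can change the angular velocities of these disks at will, leaving
the other disks unchanged.

Suppose the disks at depth less than `d` are settable. A single *visitor* (`exists_visitor`) is sent
to disk `d`. It arrives with a huge normal velocity `V` and with tangential velocity exactly equal to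
the value wanted for the disk; it leaves with the old angular velocity of the disk as its tangential
velocity, hence almost along the normal, and so it gets back to the previous cell, or to the bath.
On its way in and out it meets only disks at depth less than `d`. While it flies, further drivers
give the next disk to be hit whatever angular velocity is needed (`Settable.escort`); since the
tangential velocity after a collision is the angular velocity of the disk before it, the visitor can
be sent away from each collision in any direction. Finally the disks at depth less than `d` are reset
(`Settable.succ`).

It remains to find a route (`IsCell.approach`). By 1-controllability each rim point has a
neighbourhood in which any two points are joined by a flight with one reflection on an arc
(`IsCell.exists_hop`): the flight which returns to its starting point is perpendicular to the arc and
transverse to the disk, and the intermediate value theorem gives the point of reflection for nearby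
end points. As the circle is connected, a particle can walk around the disk in finitely many hops
(`IsCell.exists_link`), and straight horizontal flights lead from one cell to the next. The route
back is the time reversal of such a route (`Travel.reverse`). All velocities on a route scale with
the initial one, and the part of the route that depends on `V` lies in a neighbourhood with uniform
bounds, so the journey takes a time `O(1 / V)`.
-/

namespace CellShape

/-! ### Paths of a single particle -/

/-- The law of motion of one particle at a single instant: at `p` the velocity changes from `v` to
`v'`. For a collision with a disk only the normal components are constrained; the tangential ones
depend on the angular velocity of the disk and are dealt with by `IsSteering`. -/
structure Passes (C : CellShape) (N : ℕ) (p v v' : ℂ) : Prop where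
  mem : p ∈ C.chain N
  corner : ∀ ℓ : Fin N, ¬ C.OnCorner ℓ p
  bath : ∀ S, p ∉ C.bath N S
  free : (∀ ℓ : Fin N, (∀ k, ¬ C.OnWall ℓ k p) ∧ ¬ C.OnDisk ℓ p) → v' = v
  wall : ∀ (ℓ : Fin N) (k : Fin C.numArcs), C.OnWall ℓ k p →
    v' = specular (C.loc ℓ p - (C.arc k).center) v
  disk : ∀ ℓ : Fin N, C.OnDisk ℓ p → inner ℝ (C.diskNormal ℓ p) v ≠ 0 ∧
    inner ℝ (C.diskNormal ℓ p) v' = -inner ℝ (C.diskNormal ℓ p) v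

/-- The raw data of a motion: position, velocity, and left limit of the velocity, at all times. -/
structure Motion where
  pos : ℝ → ℂ
  vel : ℝ → ℂ
  velPre : ℝ → ℂ

/-- The motion `γ` is a possible motion of a particle during `(s, u)`, if the disks have suitable
angular velocities whenever they are hit. Only the disks `ℓ` with `D ℓ` are hit, and only finitely
often. Nothing is required of the instants `s` and `u` themselves, so that paths can be joined by
any change of velocity allowed by `Passes`. -/
structure IsPath (C : CellShape) {N : ℕ} (D : Fin N → Prop) (γ : Motion) (s u : ℝ) : Prop where
  right : ∀ t, s ≤ t → t < u → ∀ᶠ t' in 𝓝[>] t,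
    γ.pos t' = γ.pos t + (t' - t) • γ.vel t ∧ γ.vel t' = γ.vel t ∧ γ.velPre t' = γ.vel t
  left : ∀ t, s < t → t ≤ u → ∀ᶠ t' in 𝓝[<] t,
    γ.pos t' = γ.pos t + (t' - t) • γ.velPre t ∧ γ.vel t' = γ.velPre t ∧ γ.velPre t' = γ.velPre t
  law : ∀ t, s < t → t < u → C.Passes N (γ.pos t) (γ.velPre t) (γ.vel t)
  hits : ∀ t, s < t → t < u → ∀ ℓ : Fin N, C.OnDisk ℓ (γ.pos t) → D ℓ
  finite : {t | s < t ∧ t < u ∧ ∃ ℓ : Fin N, C.OnDisk ℓ (γ.pos t)}.Finite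

/-- During `[s, u]` a particle can go from `p`, with initial velocity `v`, to `p'`, with final
velocity `v'`, hitting only disks `ℓ` with `D ℓ` on the way. -/
def Travel (C : CellShape) {N : ℕ} (D : Fin N → Prop) (s u : ℝ) (p v p' v' : ℂ) : Prop :=
  ∃ γ : Motion, C.IsPath D γ s u ∧ γ.pos s = p ∧ γ.vel s = v ∧ γ.pos u = p' ∧ γ.velPre u = v'

variable {C : CellShape} {N : ℕ} {D D' : Fin N → Prop}

/-- The motion that follows `γ₁` until time `t` and `γ₂` from then on. -/
noncomputable def Motion.glue (γ₁ γ₂ : Motion) (t : ℝ) : Motion where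
  pos x := if x < t then γ₁.pos x else γ₂.pos x
  vel x := if x < t then γ₁.vel x else γ₂.vel x
  velPre x := if x ≤ t then γ₁.velPre x else γ₂.velPre x

theorem IsPath.mono {γ : Motion} {s u : ℝ} (h : C.IsPath D γ s u) (hD : ∀ ℓ, D ℓ → D' ℓ) :
    C.IsPath D' γ s u :=
  ⟨h.right, h.left, h.law, fun t h1 h2 ℓ hℓ => hD ℓ (h.hits t h1 h2 ℓ hℓ), h.finite⟩

theorem IsPath.glue {γ₁ γ₂ : Motion} {s t u : ℝ} (h₁ : C.IsPath D γ₁ s t)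
    (h₂ : C.IsPath D γ₂ t u) (hpos : γ₁.pos t = γ₂.pos t)
    (hlaw : C.Passes N (γ₂.pos t) (γ₁.velPre t) (γ₂.vel t))
    (hD : ∀ ℓ : Fin N, C.OnDisk ℓ (γ₂.pos t) → D ℓ) : C.IsPath D (γ₁.glue γ₂ t) s u := by
  refine ⟨fun x h1 h2 => ?_, fun x h1 h2 => ?_, fun x h1 h2 => ?_, fun x h1 h2 ℓ hℓ => ?_, ?_⟩
  · rcases lt_or_ge x t with hx | hx
    · filter_upwards [h₁.right x h1 hx, nhdsWithin_le_nhds (Iio_mem_nhds hx)] with y hy hyt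
      have hyt : y < t := hyt
      simpa [Motion.glue, hx, hyt, hyt.le] using hy
    · filter_upwards [h₂.right x hx h2, self_mem_nhdsWithin] with y hy hyx
      have hyx : t < y := hx.trans_lt hyx
      simpa [Motion.glue, hx.not_gt, hyx.not_gt, hyx.not_ge] using hy
  · rcases le_or_gt x t with hx | hx
    · filter_upwards [h₁.left x h1 hx, self_mem_nhdsWithin] with y hy hyx
      have hyt : y < t := lt_of_lt_of_le hyx hx
      rcases hx.lt_or_eq with hx' | rfl
      · simpa [Motion.glue, hx, hx', hyt, hyt.le] using hy
      · simpa [Motion.glue, hyt, hyt.le, hpos] using hy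
    · filter_upwards [h₂.left x hx h2, nhdsWithin_le_nhds (Ioi_mem_nhds hx)] with y hy hyt
      have hyt : t < y := hyt
      simpa [Motion.glue, hx.not_gt, hx.not_ge, hyt.not_gt, hyt.not_ge] using hy
  · rcases lt_trichotomy x t with hx | rfl | hx
    · simpa [Motion.glue, hx, hx.le] using h₁.law x h1 hx
    · simpa [Motion.glue] using hlaw
    · simpa [Motion.glue, hx.not_gt, hx.not_ge] using h₂.law x hx h2
  · rcases lt_trichotomy x t with hx | rfl | hx
    · exact h₁.hits x h1 hx ℓ (by simpa [Motion.glue, hx] using hℓ)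
    · exact hD ℓ (by simpa [Motion.glue] using hℓ)
    · exact h₂.hits x hx h2 ℓ (by simpa [Motion.glue, hx.not_gt] using hℓ)
  · refine ((h₁.finite.union h₂.finite).union (Set.finite_singleton t)).subset ?_
    rintro x ⟨h1, h2, ℓ, hℓ⟩
    rcases lt_trichotomy x t with hx | rfl | hx
    · exact Or.inl (Or.inl ⟨h1, hx, ℓ, by simpa [Motion.glue, hx] using hℓ⟩)
    · exact Or.inr rfl
    · exact Or.inl (Or.inr ⟨hx, h2, ℓ, by simpa [Motion.glue, hx.not_gt] using hℓ⟩)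

theorem Travel.trans {s t u : ℝ} {p v q w w' p' v' : ℂ} (hst : s < t) (htu : t < u)
    (h₁ : C.Travel D s t p v q w) (h₂ : C.Travel D t u q w' p' v') (hlaw : C.Passes N q w w')
    (hD : ∀ ℓ : Fin N, C.OnDisk ℓ q → D ℓ) : C.Travel D s u p v p' v' := by
  obtain ⟨γ₁, h₁, e1, e2, e3, e4⟩ := h₁
  obtain ⟨γ₂, h₂, f1, f2, f3, f4⟩ := h₂
  subst e1 e2 e4 f2 f3 f4
  refine ⟨γ₁.glue γ₂ t, h₁.glue h₂ (e3.trans f1.symm) (by rwa [f1]) (by rwa [f1]), ?_⟩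
  simp [Motion.glue, hst, htu.not_gt, htu.not_ge]

/-- A straight flight through points at which nothing happens. -/
theorem Travel.straight {s u : ℝ} {p v p' : ℂ} (hp' : p' = p + (u - s) • v)
    (hfree : ∀ t, s < t → t < u → C.Passes N (p + (t - s) • v) v v ∧
      ∀ ℓ : Fin N, ¬ C.OnDisk ℓ (p + (t - s) • v)) : C.Travel D s u p v p' v := by
  refine ⟨⟨fun t => p + (t - s) • v, fun _ => v, fun _ => v⟩, ⟨?_, ?_, ?_, ?_, ?_⟩, ?_, rfl, ?_, rfl⟩
  · intro t _ _
    refine Eventually.of_forall fun t' => ⟨?_, rfl, rfl⟩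
    simp only [Complex.real_smul]; push_cast; ring
  · intro t _ _
    refine Eventually.of_forall fun t' => ⟨?_, rfl, rfl⟩
    simp only [Complex.real_smul]; push_cast; ring
  · exact fun t h1 h2 => (hfree t h1 h2).1
  · exact fun t h1 h2 ℓ hℓ => ((hfree t h1 h2).2 ℓ hℓ).elim
  · convert Set.finite_empty
    refine Set.eq_empty_of_forall_notMem ?_
    rintro t ⟨h1, h2, ℓ, hℓ⟩
    exact (hfree t h1 h2).2 ℓ hℓ
  · simp
  · exact hp'.symm

theorem specular_specular (n v : ℂ) : specular n (specular n v) = v := by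
  rcases eq_or_ne n 0 with rfl | hn
  · simp [specular]
  · have : ‖n‖ ^ 2 ≠ 0 := by positivity
    simp only [specular, inner_sub_right, inner_smul_right, real_inner_self_eq_norm_sq, sub_sub,
      ← add_smul]
    rw [sub_eq_self]
    convert zero_smul ℝ n
    field_simp
    ring

theorem specular_neg (n v : ℂ) : specular n (-v) = -specular n v := by
  simp only [specular, inner_neg_right, mul_neg, neg_div, neg_smul]
  ring

/-- The law of motion of a particle is invariant under time reversal. -/
theorem Passes.reverse {p v v' : ℂ} (h : C.Passes N p v v') : C.Passes N p (-v') (-v) := by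
  refine ⟨h.mem, h.corner, h.bath, fun hf => by rw [h.free hf], fun ℓ k hk => ?_, fun ℓ hℓ => ?_⟩
  · rw [h.wall ℓ k hk, specular_neg, specular_specular]
  · have := h.disk ℓ hℓ
    rw [inner_neg_right, inner_neg_right, this.2]
    simpa using this.1

theorem tendsto_sub_nhdsGT (c t : ℝ) : Tendsto (fun x => c - x) (𝓝[>] t) (𝓝[<] (c - t)) := by
  refine tendsto_nhdsWithin_iff.2 ⟨?_, ?_⟩
  · exact ((continuous_const.sub continuous_id).tendsto t).mono_left nhdsWithin_le_nhds
  · filter_upwards [self_mem_nhdsWithin] with x hx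
    exact sub_lt_sub_left hx c

theorem tendsto_sub_nhdsLT (c t : ℝ) : Tendsto (fun x => c - x) (𝓝[<] t) (𝓝[>] (c - t)) := by
  refine tendsto_nhdsWithin_iff.2 ⟨?_, ?_⟩
  · exact ((continuous_const.sub continuous_id).tendsto t).mono_left nhdsWithin_le_nhds
  · filter_upwards [self_mem_nhdsWithin] with x hx
    exact sub_lt_sub_left hx c

theorem Travel.reverse {s u : ℝ} {p v p' v' : ℂ} (h : C.Travel D s u p v p' v') :
    C.Travel D s u p' (-v') p (-v) := by
  obtain ⟨γ, h, e1, e2, e3, e4⟩ := h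
  refine ⟨⟨fun t => γ.pos (s + u - t), fun t => -γ.velPre (s + u - t), fun t => -γ.vel (s + u - t)⟩,
    ⟨?_, ?_, ?_, ?_, ?_⟩, ?_⟩
  · intro t h1 h2
    filter_upwards [(tendsto_sub_nhdsGT (s + u) t).eventually
      (h.left (s + u - t) (by linarith) (by linarith))] with x hx
    refine ⟨?_, ?_, ?_⟩
    · simp only [hx.1, Complex.real_smul]; push_cast; ring
    · simp only [hx.2.2]
    · simp only [hx.2.1]
  · intro t h1 h2
    filter_upwards [(tendsto_sub_nhdsLT (s + u) t).eventually
      (h.right (s + u - t) (by linarith) (by linarith))] with x hx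
    refine ⟨?_, ?_, ?_⟩
    · simp only [hx.1, Complex.real_smul]; push_cast; ring
    · simp only [hx.2.2]
    · simp only [hx.2.1]
  · exact fun t h1 h2 => (h.law (s + u - t) (by linarith) (by linarith)).reverse
  · exact fun t h1 h2 ℓ hℓ => h.hits (s + u - t) (by linarith) (by linarith) ℓ hℓ
  · refine (h.finite.image fun t => s + u - t).subset ?_
    rintro t ⟨h1, h2, ℓ, hℓ⟩
    exact ⟨s + u - t, ⟨by linarith, by linarith, ℓ, hℓ⟩, by ring⟩
  · simp [e1, e2, e3, e4]

/-! ### Drivers and their effect on the disks -/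

/-- A driver: a particle which is injected from the bath on side `S` at time `enter` and which
leaves the chain through the same opening at time `exit`. -/
structure Driver (C : CellShape) (N : ℕ) (S : Side) where
  enter : ℝ
  exit : ℝ
  motion : Motion
  enter_lt_exit : enter < exit
  isPath : C.IsPath (fun _ : Fin N => True) motion enter exit
  enter_mem : motion.pos enter ∈ C.bath N S
  enter_im : |(motion.pos enter).im| < C.halfOpening
  inward : S.Inward (motion.vel enter)
  exit_mem : motion.pos exit ∈ C.bath N S
  exit_im : |(motion.pos exit).im| < C.halfOpening

variable {S : Side}

/-- The driver hits disk `ℓ` at time `t`. -/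
def Driver.Hits (f : Driver C N S) (t : ℝ) (ℓ : Fin N) : Prop :=
  f.enter < t ∧ t < f.exit ∧ C.OnDisk ℓ (f.motion.pos t)

/-- During `(s, u]` the angular velocities `ω` of the disks (with left limits `ωPre`) are compatible
with the motion of the drivers in `F`, in the absence of other collisions. -/
structure IsSteering (F : Set (Driver C N S)) (s u : ℝ) (ω ωPre : ℝ → Fin N → ℝ) : Prop where
  right : ∀ t, s ≤ t → t < u → ∀ᶠ t' in 𝓝[>] t, ω t' = ω t
  left : ∀ t, s < t → t ≤ u → ∀ᶠ t' in 𝓝[<] t, ω t' = ωPre t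
  hit : ∀ f ∈ F, ∀ t, s < t → t ≤ u → ∀ ℓ, f.Hits t ℓ →
    ωPre t ℓ = inner ℝ (C.diskTangent ℓ (f.motion.pos t)) (f.motion.vel t) ∧
    ω t ℓ = inner ℝ (C.diskTangent ℓ (f.motion.pos t)) (f.motion.velPre t)
  free : ∀ t, s < t → t ≤ u → ∀ ℓ, (∀ f ∈ F, ¬ f.Hits t ℓ) → ω t ℓ = ωPre t ℓ
  inj : ∀ f ∈ F, ∀ g ∈ F, ∀ t, s < t → t ≤ u → ∀ ℓ, f.Hits t ℓ → g.Hits t ℓ → f = g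

/-- During `(s, u]` the drivers in `F` change the angular velocities of the disks from `Ω` to
`Ω'`. -/
def Steers (F : Set (Driver C N S)) (s u : ℝ) (Ω Ω' : Fin N → ℝ) : Prop :=
  ∃ ω ωPre, IsSteering F s u ω ωPre ∧ ω s = Ω ∧ ω u = Ω'

variable {F G : Set (Driver C N S)}

theorem IsSteering.glue {s t u : ℝ} {ω₁ ωPre₁ ω₂ ωPre₂ : ℝ → Fin N → ℝ}
    (h₁ : IsSteering F s t ω₁ ωPre₁) (h₂ : IsSteering F t u ω₂ ωPre₂) (h : ω₁ t = ω₂ t) :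
    IsSteering F s u (fun x => if x ≤ t then ω₁ x else ω₂ x)
      (fun x => if x ≤ t then ωPre₁ x else ωPre₂ x) := by
  refine ⟨fun x h1 h2 => ?_, fun x h1 h2 => ?_, fun f hf x h1 h2 => ?_, fun x h1 h2 => ?_,
    fun f hf g hg x h1 h2 => ?_⟩
  · rcases lt_or_ge x t with hx | hx
    · filter_upwards [h₁.right x h1 hx, nhdsWithin_le_nhds (Iio_mem_nhds hx)] with y hy hyt
      have hyt : y < t := hyt
      simpa [hx.le, hyt.le] using hy
    · filter_upwards [h₂.right x hx h2, self_mem_nhdsWithin] with y hy hyx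
      have hyx : t < y := hx.trans_lt hyx
      rcases hx.eq_or_lt with rfl | hx'
      · have hyx : t < y := hyx
        simpa [hyx.not_ge, h] using hy
      · simpa [hx'.not_ge, hyx.not_ge] using hy
  · rcases le_or_gt x t with hx | hx
    · filter_upwards [h₁.left x h1 hx, self_mem_nhdsWithin] with y hy hyx
      have hyt : y < t := lt_of_lt_of_le hyx hx
      simpa [hx, hyt.le] using hy
    · filter_upwards [h₂.left x hx h2, nhdsWithin_le_nhds (Ioi_mem_nhds hx)] with y hy hyt
      have hyt : t < y := hyt
      simpa [hx.not_ge, hyt.not_ge] using hy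
  · rcases le_or_gt x t with hx | hx
    · simpa [hx] using h₁.hit f hf x h1 hx
    · simpa [hx.not_ge] using h₂.hit f hf x hx h2
  · rcases le_or_gt x t with hx | hx
    · simpa [hx] using h₁.free x h1 hx
    · simpa [hx.not_ge] using h₂.free x hx h2
  · rcases le_or_gt x t with hx | hx
    · exact h₁.inj f hf g hg x h1 hx
    · exact h₂.inj f hf g hg x hx h2

theorem Steers.trans {s t u : ℝ} {Ω Ω' Ω'' : Fin N → ℝ} (hst : s ≤ t) (htu : t ≤ u)
    (h₁ : Steers F s t Ω Ω') (h₂ : Steers F t u Ω' Ω'') : Steers F s u Ω Ω'' := by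
  obtain ⟨ω₁, ωPre₁, h₁, e1, e2⟩ := h₁
  obtain ⟨ω₂, ωPre₂, h₂, f1, f2⟩ := h₂
  refine ⟨_, _, h₁.glue h₂ (e2.trans f1.symm), by simp [hst, e1], ?_⟩
  rcases htu.eq_or_lt with rfl | h
  · simp [e2, ← f1, f2]
  · simp [h.not_ge, f2]

theorem IsSteering.idle {s u : ℝ} (Ω : Fin N → ℝ)
    (h : ∀ f ∈ F, ∀ t, s < t → t ≤ u → ∀ ℓ, ¬ f.Hits t ℓ) :
    IsSteering F s u (fun _ => Ω) (fun _ => Ω) :=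
  ⟨fun _ _ _ => Eventually.of_forall fun _ => rfl, fun _ _ _ => Eventually.of_forall fun _ => rfl,
    fun f hf t h1 h2 ℓ hℓ => (h f hf t h1 h2 ℓ hℓ).elim, fun _ _ _ _ _ => rfl,
    fun f hf _ _ t h1 h2 ℓ hℓ => (h f hf t h1 h2 ℓ hℓ).elim⟩

theorem Steers.idle {s u : ℝ} (Ω : Fin N → ℝ)
    (h : ∀ f ∈ F, ∀ t, s < t → t ≤ u → ∀ ℓ, ¬ f.Hits t ℓ) : Steers F s u Ω Ω :=
  ⟨_, _, IsSteering.idle Ω h, rfl, rfl⟩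

/-- The elementary step: one driver hits one disk, at time `u`, and nothing else happens. -/
theorem Steers.single {s u : ℝ} (hsu : s < u) {Ω : Fin N → ℝ} {f : Driver C N S} {ℓ : Fin N}
    (hf : f.Hits u ℓ) (hℓ : ∀ ℓ', f.Hits u ℓ' → ℓ' = ℓ)
    (hbefore : ∀ t, s < t → t < u → ∀ ℓ', ¬ f.Hits t ℓ')
    (hΩ : Ω ℓ = inner ℝ (C.diskTangent ℓ (f.motion.pos u)) (f.motion.vel u)) :
    Steers {f} s u Ω (Function.update Ω ℓ
      (inner ℝ (C.diskTangent ℓ (f.motion.pos u)) (f.motion.velPre u))) := by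
  set Ω' := Function.update Ω ℓ
      (inner ℝ (C.diskTangent ℓ (f.motion.pos u)) (f.motion.velPre u)) with hΩ'
  refine ⟨fun t => if t < u then Ω else Ω', fun _ => Ω, ⟨?_, ?_, ?_, ?_, ?_⟩, by simp [hsu],
    by simp⟩
  · intro t _ h2
    filter_upwards [nhdsWithin_le_nhds (Iio_mem_nhds h2)] with y hy
    have hy : y < u := hy
    simp [hy, h2]
  · intro t _ h2
    filter_upwards [self_mem_nhdsWithin] with y hy
    have hy : y < u := lt_of_lt_of_le hy h2
    simp [hy]
  · rintro g rfl t h1 h2 ℓ' h'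
    rcases h2.lt_or_eq with h2 | rfl
    · exact (hbefore t h1 h2 ℓ' h').elim
    · obtain rfl := hℓ ℓ' h'
      simp [hΩ', hΩ]
  · intro t h1 h2 ℓ' h'
    rcases h2.lt_or_eq with h2 | rfl
    · simp [h2]
    · have : ℓ' ≠ ℓ := fun e => h' f rfl (e ▸ hf)
      simp [hΩ', this]
  · rintro g rfl g' rfl t _ _ _ _ _
    rfl

/-- Drivers which hit no disk may be added. -/
theorem Steers.mono {s u : ℝ} {Ω Ω' : Fin N → ℝ} (h : Steers F s u Ω Ω') (hFG : F ⊆ G)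
    (hG : ∀ f ∈ G, f ∉ F → ∀ t, s < t → t ≤ u → ∀ ℓ, ¬ f.Hits t ℓ) : Steers G s u Ω Ω' := by
  obtain ⟨ω, ωPre, h, e⟩ := h
  have key : ∀ f ∈ G, ∀ t, s < t → t ≤ u → ∀ ℓ, f.Hits t ℓ → f ∈ F := fun f hf t h1 h2 ℓ hℓ =>
    by_contra fun hn => hG f hf hn t h1 h2 ℓ hℓ
  refine ⟨ω, ωPre, ⟨h.right, h.left, fun f hf t h1 h2 ℓ hℓ => ?_, fun t h1 h2 ℓ hℓ => ?_,
    fun f hf g hg t h1 h2 ℓ hℓ hℓ' => ?_⟩, e⟩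
  · exact h.hit f (key f hf t h1 h2 ℓ hℓ) t h1 h2 ℓ hℓ
  · exact h.free t h1 h2 ℓ fun f hf => hℓ f (hFG hf)
  · exact h.inj f (key f hf t h1 h2 ℓ hℓ) g (key g hg t h1 h2 ℓ hℓ') t h1 h2 ℓ hℓ hℓ'

end CellShape


namespace CellShape

/-! ### Geometry of a cell -/

variable {C : CellShape} {N : ℕ}

theorem circlePt_sub (c : ℂ) (ρ t : ℝ) : circlePt c ρ t - c = ρ * ⟨Real.cos t, Real.sin t⟩ := by
  simp [circlePt]

@[simp] theorem circlePt_re (c : ℂ) (ρ t : ℝ) : (circlePt c ρ t).re = c.re + ρ * Real.cos t := by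
  simp [circlePt]

@[simp] theorem circlePt_im (c : ℂ) (ρ t : ℝ) : (circlePt c ρ t).im = c.im + ρ * Real.sin t := by
  simp [circlePt]

theorem norm_cos_sin (t : ℝ) : ‖(⟨Real.cos t, Real.sin t⟩ : ℂ)‖ = 1 := by
  rw [Complex.norm_def, Complex.normSq_mk, Real.sqrt_eq_one]
  nlinarith [Real.sin_sq_add_cos_sq t]

theorem dist_circlePt {c : ℂ} {ρ : ℝ} (hρ : 0 < ρ) (t : ℝ) : dist (circlePt c ρ t) c = ρ := by
  rw [dist_eq_norm, circlePt_sub, norm_mul, norm_cos_sin, Complex.norm_real, Real.norm_eq_abs,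
    abs_of_pos hρ, mul_one]

theorem continuous_circlePt (c : ℂ) (ρ : ℝ) : Continuous (circlePt c ρ) := by
  have : circlePt c ρ = fun t => c + ρ * (Real.cos t + Real.sin t * Complex.I) := by
    funext t
    apply Complex.ext <;> simp [Complex.cos_ofReal_re, Complex.sin_ofReal_re]
  rw [this]
  fun_prop

theorem dist_of_mem_carrier {A : CircArc} {z : ℂ} (hz : z ∈ A.carrier) :
    dist z A.center = A.radius := by
  obtain ⟨t, -, rfl⟩ := hz
  exact dist_circlePt A.radius_pos t

theorem specular_smul {μ : ℝ} (hμ : μ ≠ 0) (n v : ℂ) : specular (μ • n) v = specular n v := by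
  rcases eq_or_ne n 0 with rfl | hn
  · simp
  · have : ‖n‖ ≠ 0 := by positivity
    simp only [specular, real_inner_smul_left, norm_smul, smul_smul, mul_pow, Real.norm_eq_abs,
      sq_abs]
    congr 2
    field_simp

/-- Moving from a point of the circle in a direction with positive normal component leads outside
the circle. -/
theorem lt_dist_of_inner_pos {o z w : ℂ} (hw : 0 < inner ℝ (z - o) w) :
    dist z o < dist (z + w) o := by
  rw [dist_eq_norm, dist_eq_norm, add_sub_right_comm]
  refine lt_of_pow_lt_pow_left₀ 2 (norm_nonneg _) ?_
  rw [norm_add_sq_real]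
  nlinarith [sq_nonneg ‖w‖]

namespace IsCell

variable (hC : C.IsCell)
include hC

theorem isClosed : IsClosed C.box := hC.closure_interior ▸ isClosed_closure

theorem frontier_subset : frontier C.box ⊆ C.box := hC.isClosed.frontier_subset

theorem carrier_subset (k : Fin C.numArcs) : (C.arc k).carrier ⊆ frontier C.box := by
  rw [hC.frontier_eq]
  exact (Set.subset_iUnion (fun k => (C.arc k).carrier) k).trans Set.subset_union_right

omit hC in
theorem not_interior {z : ℂ} (hz : z ∈ frontier C.box) : z ∉ interior C.box := hz.2

theorem center_mem : C.diskCenter ∈ interior C.box :=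
  hC.disk_subset (Metric.mem_closedBall_self hC.diskRadius_pos.le)

theorem re_of_interior {p : ℂ} (hp : p ∈ interior C.box) : 0 < p.re ∧ p.re < C.width := by
  obtain ⟨ε, hε, h⟩ := Metric.isOpen_iff.1 isOpen_interior p hp
  have key : ∀ x : ℝ, |x| < ε → p + x ∈ C.box := fun x hx =>
    interior_subset (h (by simpa [Metric.mem_ball, dist_eq_norm] using hx))
  have h1 := hC.width_spec _ (key (ε / 2) (by rw [abs_of_pos (by linarith)]; linarith))
  have h2 := hC.width_spec _ (key (-(ε / 2)) (by rw [abs_neg, abs_of_pos (by linarith)]; linarith))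
  simp only [Complex.add_re, Complex.ofReal_re, Set.mem_Icc] at h1 h2
  exact ⟨by linarith, by linarith⟩

theorem radius_lt : C.diskRadius < C.width / 2 := by
  have : C.diskCenter + C.diskRadius ∈ interior C.box := hC.disk_subset (by
    simp [Metric.mem_closedBall, dist_eq_norm, abs_of_pos hC.diskRadius_pos])
  have := (hC.re_of_interior this).2
  simp only [diskCenter, Complex.add_re, Complex.ofReal_re] at this
  linarith

theorem width_pos : 0 < C.width := by linarith [hC.radius_lt, hC.diskRadius_pos]

/-- The box is star-shaped about the centre of the disk. -/
theorem star_interior {z x : ℂ} (hz : z ∈ frontier C.box) (hx : x ∈ segment ℝ C.diskCenter z)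
    (hxz : x ≠ z) : x ∈ interior C.box := by
  have hpre : IsPreconnected (segment ℝ C.diskCenter x) := (convex_segment _ _).isPreconnected
  have hsub : segment ℝ C.diskCenter x ⊆ segment ℝ C.diskCenter z :=
    (convex_segment _ _).segment_subset (left_mem_segment _ _ _) hx
  have hzx : z ∉ segment ℝ C.diskCenter x := by
    intro h
    obtain ⟨a, b, ha, hb, hab, rfl⟩ := hx
    obtain ⟨a', b', ha', hb', hab', h⟩ := h
    have hcz : C.diskCenter ≠ z := by
      rintro rfl
      exact not_interior hz hC.center_mem
    have : ((a' + b' * a) : ℝ) • (C.diskCenter - z) = 0 := by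
      have : a' = 1 - b' := by linarith
      have : a = 1 - b := by linarith
      subst a' a
      simp only [Complex.real_smul] at h ⊢
      push_cast at h ⊢
      linear_combination h
    rcases smul_eq_zero.1 this with h0 | h0
    · have h1 : a' = 0 := by nlinarith [mul_nonneg hb' ha]
      have h2 : b' = 1 := by linarith
      have h3 : a = 0 := by rw [h1, h2] at h0; linarith
      have h4 : b = 1 := by linarith
      exact hxz (by simp [h3, h4])
    · exact hcz (sub_eq_zero.1 h0)
  have hdisj : Disjoint (segment ℝ C.diskCenter x) (frontier C.box) := by
    rw [Set.disjoint_left]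
    intro y hy hyf
    have : y ∈ segment ℝ C.diskCenter z ∩ frontier C.box := ⟨hsub hy, hyf⟩
    rw [hC.star z hz] at this
    exact hzx (Set.mem_singleton_iff.1 this ▸ hy)
  have hcov : segment ℝ C.diskCenter x ⊆ interior C.box ∪ C.boxᶜ := fun y hy =>
    or_iff_not_imp_right.2 fun h => by_contra fun h' =>
      Set.disjoint_left.1 hdisj hy ⟨subset_closure (not_not.1 h), h'⟩
  have := hpre.subset_left_of_subset_union isOpen_interior hC.isClosed.isOpen_compl
    (Set.disjoint_left.2 fun y h h' => h' (interior_subset h)) hcov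
    ⟨_, left_mem_segment _ _ _, hC.center_mem⟩
  exact this (right_mem_segment _ _ _)

/-- The point `±L/2 ± i y` of an opening, relative to the centre of the disk. -/
theorem opening_mem {e y : ℝ} (he : e = 1 ∨ e = -1) (hy : |y| ≤ C.halfOpening) :
    C.diskCenter + e * (⟨C.width / 2, y⟩ : ℂ) ∈ frontier C.box := by
  rw [hC.frontier_eq]
  left
  rcases he with rfl | rfl
  · right
    simp [vertSeg, diskCenter, hy]
  · left
    simp [vertSeg, diskCenter, hy]

/-- The triangles spanned by the centre of the disk and the openings lie in the box. -/
theorem wedge {e x y : ℝ} (he : e = 1 ∨ e = -1) (hx : 0 < x) (hxL : x < C.width / 2)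
    (hy : |y| < 2 * C.halfOpening / C.width * x) :
    C.diskCenter + e * (⟨x, y⟩ : ℂ) ∈ interior C.box := by
  have hL := hC.width_pos
  have hyx : |y * C.width / (2 * x)| ≤ C.halfOpening := by
    rw [abs_div, abs_mul, abs_of_pos hL, abs_of_pos (by linarith : 0 < 2 * x)]
    rw [div_le_iff₀ (by linarith)]
    have := mul_lt_mul_of_pos_right hy hL
    have e1 : 2 * C.halfOpening / C.width * x * C.width = C.halfOpening * (2 * x) := by
      field_simp
    linarith
  have h1 : 2 * x / C.width < 1 := by rw [div_lt_one hL]; linarith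
  refine hC.star_interior (hC.opening_mem he hyx) ⟨1 - 2 * x / C.width, 2 * x / C.width,
    by linarith, by positivity, by ring, ?_⟩ ?_
  · have hx0 : (x : ℂ) ≠ 0 := by exact_mod_cast hx.ne'
    have hL0 : (C.width : ℂ) ≠ 0 := by exact_mod_cast hL.ne'
    have e1 : (2 * x / C.width) * (C.width / 2) = x := by field_simp
    have e2 : (2 * x / C.width) * (y * C.width / (2 * x)) = y := by field_simp
    apply Complex.ext <;> simp
    · linear_combination e * e1
    · linear_combination e * e2
  · intro h
    have := congrArg Complex.re (add_left_cancel h)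
    rcases he with rfl | rfl <;> simp at this <;> linarith

/-- The arcs do not touch the openings, except at their end points. -/
theorem arc_opening {k : Fin C.numArcs} {z : ℂ} (hz : z ∈ (C.arc k).carrier)
    (hre : z.re = 0 ∨ z.re = C.width) : C.halfOpening ≤ |z.im| := by
  by_contra! him
  have hL := hC.width_pos
  obtain ⟨e, he, hze⟩ : ∃ e : ℝ, (e = 1 ∨ e = -1) ∧ z.re = C.width / 2 + e * (C.width / 2) := by
    rcases hre with h | h
    · exact ⟨-1, Or.inr rfl, by rw [h]; ring⟩
    · exact ⟨1, Or.inl rfl, by rw [h]; ring⟩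
  have hee : e * e = 1 := by rcases he with rfl | rfl <;> norm_num
  -- points of the arc close to `z` have to lie on the line through the opening
  have hnear : ∀ᶠ w in 𝓝 z, w ∈ frontier C.box → w.re = z.re := by
    have c1 : ∀ᶠ w : ℂ in 𝓝 z, 0 < e * (w.re - C.width / 2) := by
      refine (isOpen_lt continuous_const (by fun_prop)).mem_nhds ?_
      rw [Set.mem_ofPred_eq, hze]
      nlinarith
    have c2 : ∀ᶠ w : ℂ in 𝓝 z,
        |w.im| < 2 * C.halfOpening / C.width * (e * (w.re - C.width / 2)) := by
      refine (isOpen_lt (by fun_prop) (by fun_prop)).mem_nhds ?_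
      rw [Set.mem_ofPred_eq, hze]
      have : 2 * C.halfOpening / C.width * (e * (C.width / 2 + e * (C.width / 2) - C.width / 2))
        = C.halfOpening * (e * e) := by field_simp; ring
      rw [this, hee]
      linarith
    filter_upwards [c1, c2] with w h1 h2 hw
    by_contra hne
    have hb := hC.width_spec w (hC.frontier_subset hw)
    have hlt : e * (w.re - C.width / 2) < C.width / 2 := by
      rcases he with rfl | rfl
      · exact lt_of_le_of_ne (by linarith [hb.2]) fun h => hne (by rw [hze]; linarith)
      · exact lt_of_le_of_ne (by linarith [hb.1]) fun h => hne (by rw [hze]; linarith)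
    refine not_interior hw ?_
    convert hC.wedge (y := e * w.im) he h1 hlt ?_
    · apply Complex.ext <;> simp [diskCenter]
      · linear_combination (C.width / 2 - w.re) * hee
      · linear_combination - w.im * hee
    · rwa [abs_mul, show |e| = 1 by rcases he with rfl | rfl <;> simp, one_mul]
  obtain ⟨t₀, ht₀, rfl⟩ := hz
  obtain ⟨ε, hε, h⟩ := Metric.eventually_nhds_iff.1
    (((continuous_circlePt (C.arc k).center (C.arc k).radius).tendsto t₀).eventually hnear)
  have hρ := (C.arc k).radius_pos
  have hcos : ∀ t ∈ Set.Icc (C.arc k).lo (C.arc k).hi, |t - t₀| < ε →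
      Real.cos t = Real.cos t₀ := by
    intro t ht htε
    have := h (y := t) (by rwa [Real.dist_eq]) (hC.carrier_subset k ⟨t, ht, rfl⟩)
    simpa [hρ.ne'] using this
  -- but the cosine is not constant on any interval
  have hlh := (C.arc k).lo_lt_hi
  set lo := (C.arc k).lo
  set hi := (C.arc k).hi
  obtain ⟨m, d, hd, hd1, hm⟩ : ∃ m d : ℝ, 0 < d ∧ d < 1 ∧
      ∀ t, |t - m| ≤ d → t ∈ Set.Icc lo hi ∧ |t - t₀| < ε := by
    set d := min (min ((hi - lo) / 4) (ε / 4)) (1 / 2) with hd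
    have d1 : d ≤ (hi - lo) / 4 := (min_le_left _ _).trans (min_le_left _ _)
    have d2 : d ≤ ε / 4 := (min_le_left _ _).trans (min_le_right _ _)
    have d3 : d ≤ 1 / 2 := min_le_right _ _
    have d0 : 0 < d := lt_min (lt_min (by linarith) (by linarith)) (by norm_num)
    rcases le_or_gt (t₀ + 2 * d) hi with h | h
    · refine ⟨t₀ + d, d, d0, by linarith, fun t ht => ?_⟩
      rw [abs_le] at ht
      refine ⟨⟨by linarith [ht₀.1], by linarith⟩, ?_⟩
      rw [abs_lt]; constructor <;> linarith
    · refine ⟨t₀ - d, d, d0, by linarith, fun t ht => ?_⟩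
      rw [abs_le] at ht
      refine ⟨⟨by linarith, by linarith [ht₀.2]⟩, ?_⟩
      rw [abs_lt]; constructor <;> linarith
  have h1 := hm m (by simp [hd.le])
  have h2 := hm (m + d) (by simp [abs_of_pos hd])
  have h3 := hm (m - d) (by simp [abs_of_pos hd])
  replace h1 := hcos m h1.1 h1.2
  replace h2 := hcos _ h2.1 h2.2
  replace h3 := hcos _ h3.1 h3.2
  rw [Real.cos_add] at h2
  rw [Real.cos_sub] at h3
  have hs : 0 < Real.sin d := Real.sin_pos_of_pos_of_lt_pi hd (by linarith [Real.pi_gt_three])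
  have hsm : Real.sin m = 0 := by
    have : Real.sin m * Real.sin d = 0 := by linarith
    exact (mul_eq_zero.1 this).resolve_right hs.ne'
  have hcm : Real.cos m * (1 - Real.cos d) = 0 := by rw [hsm] at h2; linarith
  have hm1 := Real.sin_sq_add_cos_sq m
  have hd1 := Real.sin_sq_add_cos_sq d
  rcases mul_eq_zero.1 hcm with h | h
  · rw [hsm, h] at hm1
    norm_num at hm1
  · nlinarith

omit hC in
theorem ends_subset (k : Fin C.numArcs) : (C.arc k).ends ⊆ (C.arc k).carrier := by
  rintro z (rfl | rfl)
  · exact ⟨_, ⟨le_rfl, (C.arc k).lo_lt_hi.le⟩, rfl⟩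
  · exact ⟨_, ⟨(C.arc k).lo_lt_hi.le, le_rfl⟩, rfl⟩

theorem corners_subset : C.corners ⊆ frontier C.box := by
  rintro z (hz | hz)
  · obtain ⟨k, hk⟩ := Set.mem_iUnion.1 hz
    exact hC.carrier_subset k (ends_subset k hk)
  · rw [hC.frontier_eq]
    left
    have := hC.halfOpening_pos.le
    rcases hz with rfl | rfl | rfl | rfl <;> simp [vertSeg, abs_of_nonneg this]

theorem corner_opening {z : ℂ} (hz : z ∈ C.corners) (hre : z.re = 0 ∨ z.re = C.width) :
    C.halfOpening ≤ |z.im| := by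
  rcases hz with hz | hz
  · obtain ⟨k, hk⟩ := Set.mem_iUnion.1 hz
    exact hC.arc_opening (ends_subset k hk) hre
  · have := hC.halfOpening_pos.le
    rcases hz with rfl | rfl | rfl | rfl <;> simp [abs_of_nonneg this]

omit hC in
theorem finite_corners : C.corners.Finite := by
  refine Set.Finite.union (Set.finite_iUnion fun k => ?_) (by simp)
  simp [CircArc.ends]

theorem eventually_interior {k : Fin C.numArcs} {z : ℂ} (hz : z ∈ (C.arc k).carrier)
    (hzc : z ∉ C.corners) :
    ∀ᶠ p in 𝓝 z, (C.arc k).radius < dist p (C.arc k).center → p ∈ interior C.box := by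
  filter_upwards [(hC.dispersing k z hz hzc).eventually_nhds] with p hp hpr
  have : ∀ᶠ q in 𝓝 p, (C.arc k).radius < dist q (C.arc k).center :=
    (isOpen_lt continuous_const (by fun_prop)).mem_nhds hpr
  rw [mem_interior_iff_mem_nhds]
  filter_upwards [hp, this] with q h1 h2 using h1.2 h2.le

theorem arc_re {k : Fin C.numArcs} {z : ℂ} (hz : z ∈ (C.arc k).carrier)
    (hzc : z ∉ C.corners) : 0 < z.re ∧ z.re < C.width := by
  -- `z` can be moved vertically into the interior
  suffices h : ∃ p ∈ interior C.box, p.re = z.re by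
    obtain ⟨p, hp, hpz⟩ := h
    exact hpz ▸ hC.re_of_interior hp
  have hd := dist_of_mem_carrier hz
  set o := (C.arc k).center
  obtain ⟨e, he1, he⟩ : ∃ e : ℝ, e ≠ 0 ∧ 0 ≤ e * (z - o).im := by
    rcases le_total 0 (z - o).im with h | h
    · exact ⟨1, one_ne_zero, by simpa using h⟩
    · exact ⟨-1, by norm_num, by linarith⟩
  have hlim : Tendsto (fun x : ℝ => z + x • ((e : ℂ) * Complex.I)) (𝓝[>] 0) (𝓝 z) := by
    have : ContinuousAt (fun x : ℝ => z + x • ((e : ℂ) * Complex.I)) 0 := by fun_prop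
    have := this.tendsto
    simp only [zero_smul, add_zero] at this
    exact this.mono_left nhdsWithin_le_nhds
  obtain ⟨x, hx, hx0⟩ := ((hlim.eventually (hC.eventually_interior hz hzc)).and
    self_mem_nhdsWithin).exists
  have hx0 : 0 < x := hx0
  refine ⟨_, hx ?_, by simp⟩
  rw [← hd, dist_eq_norm, dist_eq_norm, add_sub_right_comm]
  refine lt_of_pow_lt_pow_left₀ 2 (norm_nonneg _) ?_
  rw [norm_add_sq_real]
  have h1 : inner ℝ (z - o) (x • ((e : ℂ) * Complex.I)) = x * (e * (z - o).im) := by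
    rw [inner_smul_right]
    simp [Complex.inner]
    ring
  have h2 : 0 < ‖x • ((e : ℂ) * Complex.I)‖ := by
    rw [norm_pos_iff]
    simp [hx0.ne', he1]
  rw [h1]
  have := mul_nonneg hx0.le he
  nlinarith [pow_pos h2 2]

/-- Two arcs that meet at a point which is not a corner have the same normal there. -/
theorem specular_eq {k k' : Fin C.numArcs} {z : ℂ} (hz : z ∈ (C.arc k).carrier)
    (hz' : z ∈ (C.arc k').carrier) (hzc : z ∉ C.corners) (v : ℂ) :
    specular (z - (C.arc k').center) v = specular (z - (C.arc k).center) v := by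
  have hd := dist_of_mem_carrier hz
  have hd' := dist_of_mem_carrier hz'
  have hρ := (C.arc k).radius_pos
  have hρ' := (C.arc k').radius_pos
  have hin' := hC.eventually_interior hz' hzc
  have hdisp := hC.dispersing k z hz hzc
  rw [← hd] at hdisp hρ
  rw [← hd'] at hin' hρ'
  set n := z - (C.arc k).center with hn
  set n' := z - (C.arc k').center with hn'
  rw [dist_eq_norm, ← hn] at hρ
  rw [dist_eq_norm, ← hn'] at hρ'
  -- a direction cannot lead into the circle `k` and out of the circle `k'`
  have key : ∀ w : ℂ, inner ℝ n w < 0 → inner ℝ n' w ≤ 0 := by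
    intro w hw
    by_contra! hw'
    have hlim : Tendsto (fun x : ℝ => z + x • w) (𝓝[>] 0) (𝓝 z) := by
      have : ContinuousAt (fun x : ℝ => z + x • w) 0 := by fun_prop
      have := this.tendsto
      simp only [zero_smul, add_zero] at this
      exact this.mono_left nhdsWithin_le_nhds
    have hsmall : ∀ᶠ x : ℝ in 𝓝[>] 0, 2 * inner ℝ n w + x * ‖w‖ ^ 2 < 0 := by
      have : ContinuousAt (fun x : ℝ => 2 * inner ℝ n w + x * ‖w‖ ^ 2) 0 := by fun_prop
      exact nhdsWithin_le_nhds (this.eventually (gt_mem_nhds (by simp only [zero_mul, add_zero]; linarith)))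
    obtain ⟨x, ⟨h1, h2⟩, h3, hx⟩ := (((hlim.eventually hin').and
      (hlim.eventually hdisp)).and (hsmall.and self_mem_nhdsWithin)).exists
    have hx : 0 < x := hx
    have hbox := interior_subset (h1 (lt_dist_of_inner_pos (by
      rw [inner_smul_right]; exact mul_pos hx hw')))
    have h4 := h2.1 hbox
    rw [dist_eq_norm, dist_eq_norm, add_sub_right_comm, ← hn] at h4
    have h5 := pow_le_pow_left₀ (norm_nonneg _) h4 2
    rw [norm_add_sq_real, inner_smul_right, norm_smul, Real.norm_eq_abs, mul_pow, sq_abs] at h5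
    nlinarith [mul_neg_of_pos_of_neg hx h3]
  have hinner : inner ℝ n n' = ‖n‖ * ‖n'‖ := by
    refine le_antisymm (real_inner_le_norm _ _) ?_
    by_contra! hlt
    have h1 := key (‖n‖ • n' - ‖n'‖ • n) (by
      rw [inner_sub_right, inner_smul_right, inner_smul_right, real_inner_self_eq_norm_sq]
      nlinarith)
    rw [inner_sub_right, inner_smul_right, inner_smul_right, real_inner_self_eq_norm_sq,
      real_inner_comm] at h1
    nlinarith
  have := inner_eq_norm_mul_iff_real.1 hinner
  rw [← specular_smul hρ.ne' n' v, ← this, specular_smul hρ'.ne']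

end IsCell

end CellShape


namespace CellShape

/-! ### Where in the chain something can happen to a particle -/

variable {C : CellShape} {N : ℕ}

theorem loc_re (ℓ : ℕ) (p : ℂ) : (C.loc ℓ p).re = p.re - ℓ * C.width := by simp [loc]

theorem loc_im (ℓ : ℕ) (p : ℂ) : (C.loc ℓ p).im = p.im := by simp [loc]

theorem norm_diskNormal (hr : 0 < C.diskRadius) {ℓ : ℕ} {p : ℂ} (hp : C.OnDisk ℓ p) :
    ‖C.diskNormal ℓ p‖ = 1 := by
  rw [OnDisk, dist_eq_norm] at hp
  rw [diskNormal, norm_smul, hp, Real.norm_eq_abs, abs_inv, abs_of_pos hr, inv_mul_cancel₀ hr.ne']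

namespace IsCell

variable (hC : C.IsCell)
include hC

theorem corner_mem_box {z : ℂ} (hz : z ∈ C.corners) : z ∈ C.box :=
  hC.frontier_subset (hC.corners_subset hz)

theorem wall_mem_box {k : Fin C.numArcs} {z : ℂ} (hz : z ∈ (C.arc k).carrier) : z ∈ C.box :=
  hC.frontier_subset (hC.carrier_subset k hz)

theorem disk_mem_interior {ℓ : ℕ} {p : ℂ} (hp : C.OnDisk ℓ p) : C.loc ℓ p ∈ interior C.box :=
  hC.disk_subset (Metric.mem_closedBall.2 (le_of_eq hp))

/-- A point strictly between the openings of a cell belongs to no other cell. -/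
theorem eq_of_mem_box {ℓ ℓ' : ℕ} {p : ℂ} (h : 0 < (C.loc ℓ p).re ∧ (C.loc ℓ p).re < C.width)
    (h' : C.loc ℓ' p ∈ C.box) : ℓ' = ℓ := by
  have hb := hC.width_spec _ h'
  have hL := hC.width_pos
  rw [loc_re] at h
  rw [loc_re, Set.mem_Icc] at hb
  have h1 : (ℓ : ℝ) < ℓ' + 1 := by
    by_contra! hle
    nlinarith [mul_le_mul_of_nonneg_right hle hL.le]
  have h2 : (ℓ' : ℝ) < ℓ + 1 := by
    by_contra! hle
    nlinarith [mul_le_mul_of_nonneg_right hle hL.le]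
  have h1 : ℓ < ℓ' + 1 := by exact_mod_cast h1
  have h2 : ℓ' < ℓ + 1 := by exact_mod_cast h2
  omega

theorem not_bath {ℓ : Fin N} {p : ℂ} (h : 0 < (C.loc ℓ p).re ∧ (C.loc ℓ p).re < C.width)
    (S : Side) : p ∉ C.bath N S := by
  have hL := hC.width_pos
  rw [loc_re] at h
  have h0 : (0 : ℝ) ≤ (ℓ : ℕ) * C.width := by positivity
  have h1 : ((ℓ : ℕ) + 1 : ℝ) * C.width ≤ N * C.width :=
    mul_le_mul_of_nonneg_right (by exact_mod_cast ℓ.2) hL.le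
  rintro hp
  cases S
  · have := hp.1
    linarith
  · have := hp.1
    linarith

/-- At a point of the open accessible region of a cell nothing happens. -/
theorem passes_free (ℓ : Fin N) {p : ℂ} (hp : C.loc ℓ p ∈ C.openRegion) (v : ℂ) :
    C.Passes N p v v ∧ ∀ ℓ' : Fin N, ¬ C.OnDisk ℓ' p := by
  have hre := hC.re_of_interior hp.1
  have key : ∀ ℓ' : Fin N, C.loc ℓ' p ∈ C.box → ℓ' = ℓ := fun ℓ' h =>
    Fin.ext (hC.eq_of_mem_box hre h)
  have hdisk : ∀ ℓ' : Fin N, ¬ C.OnDisk ℓ' p := by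
    intro ℓ' h
    obtain rfl := key ℓ' (interior_subset (hC.disk_mem_interior h))
    exact hp.2 (Metric.mem_closedBall.2 (le_of_eq h))
  refine ⟨⟨⟨ℓ, interior_subset hp.1, fun h => hp.2 (Metric.ball_subset_closedBall h)⟩,
    fun ℓ' h => ?_, hC.not_bath hre, fun _ => rfl, fun ℓ' k h => ?_, fun ℓ' h => (hdisk ℓ' h).elim⟩,
    hdisk⟩
  · obtain rfl := key ℓ' (hC.corner_mem_box h)
    exact not_interior (hC.corners_subset h) hp.1
  · obtain rfl := key ℓ' (hC.wall_mem_box h)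
    exact (not_interior (hC.carrier_subset k h) hp.1).elim

theorem re_of_opening {k : ℕ} {p : ℂ} (hre : p.re = k * C.width) (ℓ : ℕ)
    (h : C.loc ℓ p ∈ C.box) : (C.loc ℓ p).re = 0 ∨ (C.loc ℓ p).re = C.width := by
  have hL := hC.width_pos
  have hb := hC.width_spec _ h
  rw [loc_re, hre, ← sub_mul, Set.mem_Icc] at hb
  have h1 : (ℓ : ℝ) ≤ k := by
    by_contra! hlt
    nlinarith
  have h2 : (k : ℝ) ≤ ℓ + 1 := by
    by_contra! hlt
    nlinarith
  have h1 : ℓ ≤ k := by exact_mod_cast h1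
  have h2 : k ≤ ℓ + 1 := by exact_mod_cast h2
  rw [loc_re, hre]
  rcases (by omega : k = ℓ ∨ k = ℓ + 1) with rfl | rfl
  · left; ring
  · right; push_cast; ring

theorem not_corner_of_opening {k : ℕ} {p : ℂ} (hre : p.re = k * C.width)
    (him : |p.im| < C.halfOpening) (ℓ : ℕ) : ¬ C.OnCorner ℓ p := by
  intro h
  have := hC.corner_opening h (hC.re_of_opening hre ℓ (hC.corner_mem_box h))
  rw [loc_im] at this
  linarith

theorem frontier_subset_region {z : ℂ} (hz : z ∈ frontier C.box) : z ∈ C.region :=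
  ⟨hC.frontier_subset hz, fun h =>
    not_interior hz (hC.disk_subset (Metric.ball_subset_closedBall h))⟩

omit hC in
theorem bath_re {S : Side} {p : ℂ} (hp : p ∈ C.bath N S) : ∃ k : ℕ, p.re = k * C.width := by
  cases S
  · exact ⟨0, by simpa using hp.1⟩
  · exact ⟨N, hp.1⟩

theorem bath_subset_chain (hN : 0 < N) {S : Side} {p : ℂ} (hp : p ∈ C.bath N S) :
    p ∈ C.chain N := by
  cases S
  · refine ⟨⟨0, hN⟩, hC.frontier_subset_region ?_⟩
    rw [hC.frontier_eq]
    exact Or.inl (Or.inl ⟨by rw [loc_re, hp.1]; simp, by rw [loc_im]; exact hp.2⟩)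
  · refine ⟨⟨N - 1, by omega⟩, hC.frontier_subset_region ?_⟩
    rw [hC.frontier_eq]
    refine Or.inl (Or.inr ⟨?_, by rw [loc_im]; exact hp.2⟩)
    rw [loc_re, hp.1, Nat.cast_sub hN]
    push_cast
    ring

/-- Particles pass freely through the openings between the cells. -/
theorem passes_opening {k : ℕ} (hk : 0 < k) (hkN : k < N) {p : ℂ} (hre : p.re = k * C.width)
    (him : |p.im| < C.halfOpening) (v : ℂ) :
    C.Passes N p v v ∧ ∀ ℓ' : Fin N, ¬ C.OnDisk ℓ' p := by
  have hL := hC.width_pos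
  have key := hC.re_of_opening hre
  have hdisk : ∀ ℓ' : Fin N, ¬ C.OnDisk ℓ' p := by
    intro ℓ' h
    have hi := hC.disk_mem_interior h
    have := hC.re_of_interior hi
    rcases key _ (interior_subset hi) with h | h <;> linarith
  refine ⟨⟨⟨⟨k - 1, by omega⟩, ?_⟩, fun ℓ' h => ?_, fun S hS => ?_, fun _ => rfl,
    fun ℓ' k' h => ?_, fun ℓ' h => (hdisk ℓ' h).elim⟩, hdisk⟩
  · have hf : C.loc (k - 1 : ℕ) p ∈ frontier C.box := by
      rw [hC.frontier_eq]
      left; right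
      refine ⟨?_, by rw [loc_im]; exact him.le⟩
      rw [loc_re, hre, Nat.cast_sub hk]
      push_cast; ring
    exact hC.frontier_subset_region hf
  · exact hC.not_corner_of_opening hre him ℓ' h
  · have h0 : (0 : ℝ) < k := by exact_mod_cast hk
    have h1 : (k : ℝ) < N := by exact_mod_cast hkN
    cases S
    · have := hS.1
      rw [hre] at this
      nlinarith
    · have := hS.1
      rw [hre] at this
      nlinarith
  · have := hC.arc_opening h (key _ (hC.wall_mem_box h))
    rw [loc_im] at this
    linarith

theorem passes_wall (ℓ : Fin N) {p : ℂ} {k : Fin C.numArcs} (hp : C.loc ℓ p ∈ (C.arc k).carrier)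
    (hpc : C.loc ℓ p ∉ C.corners) (v : ℂ) :
    C.Passes N p v (specular (C.loc ℓ p - (C.arc k).center) v) ∧
      ∀ ℓ' : Fin N, ¬ C.OnDisk ℓ' p := by
  have hre := hC.arc_re hp hpc
  have hf := hC.carrier_subset k hp
  have key : ∀ ℓ' : Fin N, C.loc ℓ' p ∈ C.box → ℓ' = ℓ := fun ℓ' h =>
    Fin.ext (hC.eq_of_mem_box hre h)
  have hdisk : ∀ ℓ' : Fin N, ¬ C.OnDisk ℓ' p := by
    intro ℓ' h
    have hi := hC.disk_mem_interior h
    obtain rfl := key ℓ' (interior_subset hi)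
    exact not_interior hf hi
  refine ⟨⟨⟨ℓ, hC.frontier_subset_region hf⟩, fun ℓ' h => ?_, hC.not_bath hre, fun h => ((h ℓ).1 k hp).elim, fun ℓ' k' h => ?_,
    fun ℓ' h => (hdisk ℓ' h).elim⟩, hdisk⟩
  · obtain rfl := key ℓ' (hC.corner_mem_box h)
    exact hpc h
  · obtain rfl := key ℓ' (hC.wall_mem_box h)
    exact hC.specular_eq h hp hpc v

theorem eq_of_onDisk {ℓ ℓ' : Fin N} {p : ℂ} (hp : C.OnDisk ℓ p) (hp' : C.OnDisk ℓ' p) :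
    ℓ' = ℓ :=
  Fin.ext (hC.eq_of_mem_box (hC.re_of_interior (hC.disk_mem_interior hp))
    (interior_subset (hC.disk_mem_interior hp')))

theorem passes_disk (ℓ : Fin N) {p v v' : ℂ} (hp : C.OnDisk ℓ p)
    (hv : inner ℝ (C.diskNormal ℓ p) v ≠ 0)
    (hv' : inner ℝ (C.diskNormal ℓ p) v' = -inner ℝ (C.diskNormal ℓ p) v) :
    C.Passes N p v v' := by
  have hi := hC.disk_mem_interior hp
  have hre := hC.re_of_interior hi
  have key : ∀ ℓ' : Fin N, C.loc ℓ' p ∈ C.box → ℓ' = ℓ := fun ℓ' h =>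
    Fin.ext (hC.eq_of_mem_box hre h)
  refine ⟨⟨ℓ, interior_subset hi, fun h => ?_⟩, fun ℓ' h => ?_, hC.not_bath hre,
    fun h => ((h ℓ).2 hp).elim, fun ℓ' k h => ?_, fun ℓ' h => ?_⟩
  · rw [Metric.mem_ball] at h
    exact h.ne hp
  · obtain rfl := key ℓ' (hC.corner_mem_box h)
    exact not_interior (hC.corners_subset h) hi
  · obtain rfl := key ℓ' (hC.wall_mem_box h)
    exact (not_interior (hC.carrier_subset k h) hi).elim
  · obtain rfl := hC.eq_of_onDisk hp h
    exact ⟨hv, hv'⟩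

end IsCell

end CellShape


namespace CellShape

/-! ### Hops: from the disk to an arc and back to the disk -/

variable {C : CellShape}

/-- The unit vector with polar angle `t`. -/
noncomputable def cis (t : ℝ) : ℂ := ⟨Real.cos t, Real.sin t⟩

theorem norm_cis (t : ℝ) : ‖cis t‖ = 1 := norm_cos_sin t

theorem continuous_cis : Continuous cis := by
  have : cis = circlePt 0 1 := by
    funext t
    simp [circlePt, cis]
  rw [this]
  exact continuous_circlePt 0 1

theorem circlePt_sub_center (c : ℂ) (ρ t : ℝ) : circlePt c ρ t - c = ρ • cis t := by
  rw [circlePt_sub, Complex.real_smul, cis]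

theorem rimPt_sub (θ : ℝ) : C.rimPt θ - C.diskCenter = C.diskRadius • cis θ :=
  circlePt_sub_center _ _ _

theorem continuous_rimPt : Continuous C.rimPt := continuous_circlePt _ _

theorem inner_cis (t : ℝ) (w : ℂ) : inner ℝ (cis t) w = Real.cos t * w.re + Real.sin t * w.im := by
  simp [Complex.inner, cis]
  ring

/-- If the segment from `z` to `w + z` avoids a disk with `z` on its rim, then `w` does not point
into the disk. -/
theorem inner_nonneg_of_forall_dist {o z w : ℂ}
    (h : ∀ x : ℝ, 0 < x → x < 1 → dist z o ≤ dist (z + x • w) o) : 0 ≤ inner ℝ (z - o) w := by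
  have hlim : Tendsto (fun x : ℝ => 2 * inner ℝ (z - o) w + x * ‖w‖ ^ 2) (𝓝[>] 0)
      (𝓝 (2 * inner ℝ (z - o) w)) := by
    have : ContinuousAt (fun x : ℝ => 2 * inner ℝ (z - o) w + x * ‖w‖ ^ 2) 0 := by fun_prop
    have := this.tendsto
    simp only [zero_mul, add_zero] at this
    exact this.mono_left nhdsWithin_le_nhds
  have : ∀ᶠ x : ℝ in 𝓝[>] 0, 0 ≤ 2 * inner ℝ (z - o) w + x * ‖w‖ ^ 2 := by
    filter_upwards [Ioo_mem_nhdsGT (zero_lt_one' ℝ)] with x hx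
    have h5 := pow_le_pow_left₀ dist_nonneg (h x hx.1 hx.2) 2
    rw [dist_eq_norm, dist_eq_norm, add_sub_right_comm, norm_add_sq_real, inner_smul_right,
      norm_smul, Real.norm_eq_abs, mul_pow, sq_abs] at h5
    by_contra! hn
    nlinarith [mul_neg_of_pos_of_neg hx.1 hn]
  linarith [ge_of_tendsto hlim this]

theorem mem_openSegment_add {p z : ℂ} {x : ℝ} (h0 : 0 < x) (h1 : x < 1) :
    p + x • (z - p) ∈ openSegment ℝ p z :=
  ⟨1 - x, x, by linarith, h0, by ring, by simp only [Complex.real_smul]; push_cast; ring⟩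

/-- A particle can only return to its starting point on the rim if it hits the arc
perpendicularly, from outside of the circle. -/
theorem IsCell.perpendicular (hC : C.IsCell) {k : Fin C.numArcs} {θ : ℝ}
    (h : C.ReturnsVia k θ θ) : ∃ z ∈ (C.arc k).carrier, z ∉ C.corners ∧
      openSegment ℝ (C.rimPt θ) z ⊆ C.openRegion ∧
      ∃ μ : ℝ, 1 < μ ∧ C.rimPt θ - (C.arc k).center = μ • (z - (C.arc k).center) := by
  obtain ⟨z, hz, hzc, hseg, -, s, hs, hsp⟩ := h
  refine ⟨z, hz, hzc, hseg, ?_⟩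
  set p := C.rimPt θ
  set o := (C.arc k).center with ho
  have hd := dist_of_mem_carrier hz
  have hρ := (C.arc k).radius_pos
  set ν : ℝ := s * (2 * inner ℝ (z - o) (z - p) / ‖z - o‖ ^ 2) / (1 + s) with hν
  have hw : z - p = ν • (z - o) := by
    have hs1 : (1 + s : ℂ) ≠ 0 := by exact_mod_cast (by linarith : (1 + s : ℝ) ≠ 0)
    rw [specular] at hsp
    rw [hν]
    simp only [Complex.real_smul] at hsp ⊢
    push_cast at hsp ⊢
    field_simp
    field_simp at hsp
    linear_combination -hsp
  refine ⟨1 - ν, ?_, ?_⟩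
  · have hsub : ∀ x : ℝ, 0 < x → x < 1 → p + x • (z - p) ∈ C.openRegion := fun x h0 h1 =>
      hseg (mem_openSegment_add h0 h1)
    -- otherwise the particle would come from inside the circle
    by_contra! hν0
    have hν0 : 0 ≤ ν := by linarith
    rcases hν0.eq_or_lt with h0 | h0
    · have hzp : z - p = 0 := by rw [hw, ← h0, zero_smul]
      have hb := hsub (1 / 2) (by norm_num) (by norm_num)
      rw [hzp, smul_zero, add_zero] at hb
      exact hb.2 (Metric.mem_closedBall.2 (dist_circlePt hC.diskRadius_pos θ).le)
    · have hlim : Tendsto (fun x : ℝ => z - x • (z - p)) (𝓝[>] 0) (𝓝 z) := by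
        have : ContinuousAt (fun x : ℝ => z - x • (z - p)) 0 := by fun_prop
        have := this.tendsto
        simp only [zero_smul, sub_zero] at this
        exact this.mono_left nhdsWithin_le_nhds
      have hx1 : ∀ᶠ x : ℝ in 𝓝[>] 0, x < 1 ∧ x * ν < 1 := by
        have : ContinuousAt (fun x : ℝ => x * ν) 0 := by fun_prop
        exact nhdsWithin_le_nhds ((gt_mem_nhds zero_lt_one).and
          (this.eventually (gt_mem_nhds (by simp))))
      obtain ⟨x, ⟨hx, hx1, hx2⟩, hx0⟩ := (((hlim.eventually (hC.dispersing k z hz hzc)).and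
        hx1).and self_mem_nhdsWithin).exists
      have hx0 : 0 < x := hx0
      have hbox : z - x • (z - p) ∈ C.box := by
        have := interior_subset (hsub (1 - x) (by linarith) (by linarith)).1
        convert this using 1
        simp only [Complex.real_smul]; push_cast; ring
      have := hx.1 hbox
      have e : z - x • (z - p) - o = (1 - x * ν) • (z - o) := by
        rw [hw]
        simp only [Complex.real_smul]; push_cast; ring
      rw [dist_eq_norm, ← ho, e, norm_smul, ← dist_eq_norm z o, Real.norm_eq_abs,
        abs_of_pos (by linarith), show dist z o = (C.arc k).radius from hd] at this
      nlinarith [mul_pos hx0 h0]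
  · simp only [Complex.real_smul] at hw ⊢
    push_cast at hw ⊢
    linear_combination -hw

/-- A particle which leaves the rim at an illuminated point towards the centre of the arc is not
tangent to the disk. -/
theorem IsCell.transverse (hC : C.IsCell) {k : Fin C.numArcs} {θ : ℝ}
    (h : θ ∈ C.illuminated k) :
    0 < inner ℝ (cis θ) ((C.arc k).center - C.rimPt θ) := by
  set o := (C.arc k).center with ho
  have hr := hC.diskRadius_pos
  have hnn : ∀ᶠ t in 𝓝 θ, 0 ≤ inner ℝ (cis t) (o - C.rimPt t) := by
    filter_upwards [mem_interior_iff_mem_nhds.1 h] with t ht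
    obtain ⟨z, -, -, hseg, μ, hμ, hz⟩ := hC.perpendicular ht
    have h1 : 0 ≤ inner ℝ (C.rimPt t - C.diskCenter) (z - C.rimPt t) := by
      refine inner_nonneg_of_forall_dist fun x h0 h1 => ?_
      have hn := (hseg (mem_openSegment_add h0 h1)).2
      rw [Metric.mem_closedBall, not_le] at hn
      exact (dist_circlePt hr t).le.trans hn.le
    have h2 : μ • (z - C.rimPt t) = (μ - 1) • (o - C.rimPt t) := by
      simp only [Complex.real_smul] at hz ⊢
      push_cast at hz ⊢
      linear_combination -hz
    have h3 := congrArg (inner ℝ (cis t)) h2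
    rw [inner_smul_right, inner_smul_right] at h3
    rw [rimPt_sub, real_inner_smul_left] at h1
    have h4 := nonneg_of_mul_nonneg_right h1 hr
    by_contra! hlt
    nlinarith [mul_nonneg (by linarith : (0 : ℝ) ≤ μ) h4,
      mul_neg_of_pos_of_neg (by linarith : 0 < μ - 1) hlt]
  have hform : ∀ t, inner ℝ (cis t) (o - C.rimPt t) =
      Real.cos t * (o - C.diskCenter).re + Real.sin t * (o - C.diskCenter).im - C.diskRadius := by
    intro t
    have : o - C.rimPt t = (o - C.diskCenter) - C.diskRadius • cis t := by
      rw [← rimPt_sub]; ring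
    rw [this, inner_sub_right, inner_smul_right, real_inner_self_eq_norm_sq, norm_cis, inner_cis]
    ring
  simp only [hform] at hnn ⊢
  set A := (o - C.diskCenter).re
  set B := (o - C.diskCenter).im
  obtain ⟨ε, hε, hε'⟩ := Metric.eventually_nhds_iff.1 hnn
  by_contra! hle
  -- a sinusoid of positive mean value has no local minimum at a positive height
  set d := min (ε / 2) 1 with hd
  have hd0 : 0 < d := lt_min (by linarith) one_pos
  have hdε : d < ε := (min_le_left _ _).trans_lt (by linarith)
  have h1 := hε' (y := θ + d) (by simpa [abs_of_pos hd0] using hdε)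
  have h2 := hε' (y := θ - d) (by simpa [Real.dist_eq, abs_of_pos hd0] using hdε)
  rw [Real.cos_add, Real.sin_add] at h1
  rw [Real.cos_sub, Real.sin_sub] at h2
  have hcos : Real.cos d < 1 := by
    have := Real.cos_lt_cos_of_nonneg_of_le_pi_div_two le_rfl
      (by linarith [Real.pi_gt_three, min_le_right (ε / 2) 1]) hd0
    simpa using this
  have hcos0 : 0 < Real.cos d := Real.cos_pos_of_mem_Ioo
    ⟨by linarith [Real.pi_gt_three], by linarith [Real.pi_gt_three, min_le_right (ε / 2) 1]⟩
  nlinarith [mul_nonneg hcos0.le (by linarith :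
    0 ≤ C.diskRadius - (Real.cos θ * A + Real.sin θ * B))]

/-- The mirror law: if the tangential components of the unit vectors along `P` and `Q` add up to
zero then `Q` has the direction of the reflection of `-P`. -/
theorem smul_specular_eq {t ρ : ℝ} {P Q : ℂ} (hρ : 0 < ρ) (hP : 0 < inner ℝ (cis t) P)
    (hQ : 0 < inner ℝ (cis t) Q)
    (h : ‖Q‖ * (Real.cos t * P.im - Real.sin t * P.re) +
      ‖P‖ * (Real.cos t * Q.im - Real.sin t * Q.re) = 0) :
    Q = (‖Q‖ / ‖P‖) • specular (ρ • cis t) (-P) := by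
  rw [specular_smul hρ.ne', specular, norm_cis, inner_neg_right]
  have hP0 : 0 < ‖P‖ := norm_pos_iff.2 (by rintro rfl; simp at hP)
  have hQ0 : 0 < ‖Q‖ := norm_pos_iff.2 (by rintro rfl; simp at hQ)
  have hcs := Real.sin_sq_add_cos_sq t
  rw [inner_cis] at hP hQ ⊢
  have nP : ‖P‖ ^ 2 = P.re ^ 2 + P.im ^ 2 := by
    rw [← Complex.normSq_eq_norm_sq, Complex.normSq_apply]; ring
  have nQ : ‖Q‖ ^ 2 = Q.re ^ 2 + Q.im ^ 2 := by
    rw [← Complex.normSq_eq_norm_sq, Complex.normSq_apply]; ring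
  set c := Real.cos t
  set s := Real.sin t
  set x := ‖P‖
  set y := ‖Q‖
  set Pn := c * P.re + s * P.im with hPn
  set Qn := c * Q.re + s * Q.im with hQn
  set Pt := c * P.im - s * P.re with hPt
  set Qt := c * Q.im - s * Q.re with hQt
  have n1 : x ^ 2 = Pn ^ 2 + Pt ^ 2 := by rw [nP]; linear_combination -(P.re ^ 2 + P.im ^ 2) * hcs
  have n2 : y ^ 2 = Qn ^ 2 + Qt ^ 2 := by rw [nQ]; linear_combination -(Q.re ^ 2 + Q.im ^ 2) * hcs
  have hn : y * Pn = x * Qn := by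
    have : (y * Pn) ^ 2 = (x * Qn) ^ 2 := by
      linear_combination y ^ 2 * (-n1) + x ^ 2 * n2 + (x * Qt - y * Pt) * h
    exact (sq_eq_sq₀ (by positivity) (by positivity)).1 this
  have r1 : Q.re = c * Qn - s * Qt := by linear_combination -Q.re * hcs
  have r2 : Q.im = s * Qn + c * Qt := by linear_combination -Q.im * hcs
  have r3 : P.re = c * Pn - s * Pt := by linear_combination -P.re * hcs
  have r4 : P.im = s * Pn + c * Pt := by linear_combination -P.im * hcs
  clear_value Pn Qn Pt Qt
  apply Complex.ext
  · simp [cis]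
    rw [r1, r3]
    field_simp
    linear_combination c * (-hn) - s * h
  · simp [cis]
    rw [r2, r4]
    field_simp
    linear_combination s * (-hn) + c * h

theorem lt_dist_of_mem_openSegment {o p z x : ℂ} (h : 0 < inner ℝ (p - o) (z - p))
    (hx : x ∈ openSegment ℝ p z) : dist p o < dist x o := by
  obtain ⟨a, b, ha, hb, hab, rfl⟩ := hx
  have e : a • p + b • z = p + b • (z - p) := by
    have : a = 1 - b := by linarith
    rw [this]
    simp only [Complex.real_smul]; push_cast; ring
  rw [e]
  exact lt_dist_of_inner_pos (by rw [inner_smul_right]; exact mul_pos hb h)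

/-- Free flights from the rim to an arc are stable under perturbations of the end points. -/
theorem IsCell.eventually_openSegment (hC : C.IsCell) {k : Fin C.numArcs} {θ₀ : ℝ} {z₀ : ℂ}
    (hz₀ : z₀ ∈ (C.arc k).carrier) (hzc : z₀ ∉ C.corners)
    (hseg : openSegment ℝ (C.rimPt θ₀) z₀ ⊆ C.openRegion)
    (h1 : 0 < inner ℝ (cis θ₀) (z₀ - C.rimPt θ₀))
    (h2 : 0 < inner ℝ (z₀ - (C.arc k).center) (C.rimPt θ₀ - z₀)) :
    ∀ᶠ q : ℝ × ℂ in 𝓝 (θ₀, z₀), q.2 ∈ (C.arc k).carrier →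
      openSegment ℝ (C.rimPt q.1) q.2 ⊆ C.openRegion := by
  obtain ⟨B, hB, hBo, hzB⟩ := eventually_nhds_iff.1 (hC.eventually_interior hz₀ hzc)
  have hcont : Continuous fun q : (ℝ × ℂ) × ℝ => C.rimPt q.1.1 + q.2 • (q.1.2 - C.rimPt q.1.1) := by
    have := C.continuous_rimPt
    fun_prop
  have htube : ∀ᶠ q : ℝ × ℂ in 𝓝 (θ₀, z₀), ∀ x ∈ Set.Icc (0 : ℝ) 1,
      C.rimPt q.1 + x • (q.2 - C.rimPt q.1) ∈ interior C.box ∪ B := by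
    refine isCompact_Icc.eventually_forall_of_forall_eventually fun x hx => ?_
    refine hcont.continuousAt.eventually_mem ((isOpen_interior.union hBo).mem_nhds ?_)
    rcases hx.1.eq_or_lt with rfl | h0
    · left
      rw [zero_smul, add_zero]
      exact hC.disk_subset (Metric.mem_closedBall.2 (dist_circlePt hC.diskRadius_pos θ₀).le)
    · rcases hx.2.eq_or_lt with rfl | h1
      · right
        simpa using hzB
      · exact Or.inl (hseg (mem_openSegment_add h0 h1)).1
  have c1 : ∀ᶠ q : ℝ × ℂ in 𝓝 (θ₀, z₀), 0 < inner ℝ (cis q.1) (q.2 - C.rimPt q.1) := by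
    have : Continuous fun q : ℝ × ℂ => inner ℝ (cis q.1) (q.2 - C.rimPt q.1) := by
      have := C.continuous_rimPt
      have := continuous_cis
      fun_prop
    exact this.continuousAt.eventually (lt_mem_nhds h1)
  have c2 : ∀ᶠ q : ℝ × ℂ in 𝓝 (θ₀, z₀),
      0 < inner ℝ (q.2 - (C.arc k).center) (C.rimPt q.1 - q.2) := by
    have : Continuous fun q : ℝ × ℂ => inner ℝ (q.2 - (C.arc k).center) (C.rimPt q.1 - q.2) := by
      have := C.continuous_rimPt
      fun_prop
    exact this.continuousAt.eventually (lt_mem_nhds h2)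
  filter_upwards [htube, c1, c2] with q ht h1 h2 hq x hx
  have hr := hC.diskRadius_pos
  have d1 : C.diskRadius < dist x C.diskCenter := by
    have := lt_dist_of_mem_openSegment (o := C.diskCenter)
      (by rw [rimPt_sub, real_inner_smul_left]; positivity) hx
    rwa [show dist (C.rimPt q.1) C.diskCenter = _ from dist_circlePt hr q.1] at this
  have d2 : (C.arc k).radius < dist x (C.arc k).center := by
    have := lt_dist_of_mem_openSegment h2 (openSegment_symm ℝ (C.rimPt q.1) q.2 ▸ hx)
    rwa [dist_of_mem_carrier hq] at this
  refine ⟨?_, by simpa using d1⟩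
  obtain ⟨a, b, ha, hb, hab, rfl⟩ := hx
  have e : a • C.rimPt q.1 + b • q.2 = C.rimPt q.1 + b • (q.2 - C.rimPt q.1) := by
    have : a = 1 - b := by linarith
    rw [this]
    simp only [Complex.real_smul]; push_cast; ring
  rcases ht b ⟨hb.le, by linarith⟩ with h | h
  · rwa [e]
  · exact hB _ (e ▸ h) d2

/-- Near an illuminated point, a particle can get from any point of the rim to any other one by a
single reflection on the arc. The bounds are uniform, and `s` is the ratio of the lengths of the two
parts of the flight. -/
theorem IsCell.exists_hop (hC : C.IsCell) {k : Fin C.numArcs} {θ₀ : ℝ}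
    (h : θ₀ ∈ C.illuminated k) : ∃ B : ℝ, 0 < B ∧ ∀ᶠ q : ℝ × ℝ in 𝓝 (θ₀, θ₀),
      ∃ z ∈ (C.arc k).carrier, z ∉ C.corners ∧
        openSegment ℝ (C.rimPt q.1) z ⊆ C.openRegion ∧
        openSegment ℝ z (C.rimPt q.2) ⊆ C.openRegion ∧
        inner ℝ (cis q.1) (z - C.rimPt q.1) ∈ Set.Icc B (4 * B) ∧
        inner ℝ (cis q.2) (z - C.rimPt q.2) ∈ Set.Icc B (4 * B) ∧
        ∃ s ∈ Set.Icc (4⁻¹ : ℝ) 4,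
          C.rimPt q.2 - z = s • specular (z - (C.arc k).center) (z - C.rimPt q.1) := by
  obtain ⟨z₀, hz₀, hzc₀, hseg₀, μ, hμ, hμz⟩ := hC.perpendicular (θ := θ₀) (k := k)
    (interior_subset (s := {θ | C.ReturnsVia k θ θ}) h)
  have htr := hC.transverse h
  set A := C.arc k with hA
  obtain ⟨t₀, ht₀, rfl⟩ := hz₀
  have hρ := A.radius_pos
  have hcz := continuous_circlePt A.center A.radius
  set z : ℝ → ℂ := circlePt A.center A.radius with hz
  have hrim := C.continuous_rimPt
  have hcis := continuous_cis
  have hsub : ∀ t, z t - A.center = A.radius • cis t := circlePt_sub_center _ _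
  have ht₀' : A.lo < t₀ ∧ t₀ < A.hi := by
    have hc : z t₀ ∉ A.ends := fun h' => hzc₀ (Or.inl (Set.mem_iUnion.2 ⟨k, h'⟩))
    constructor
    · refine lt_of_le_of_ne ht₀.1 ?_
      rintro rfl
      exact hc (Or.inl rfl)
    · refine lt_of_le_of_ne ht₀.2 ?_
      rintro rfl
      exact hc (Or.inr rfl)
  have hout : 0 < inner ℝ (z t₀ - A.center) (C.rimPt θ₀ - z t₀) := by
    have : C.rimPt θ₀ - z t₀ = (μ - 1) • (z t₀ - A.center) := by
      simp only [Complex.real_smul] at hμz ⊢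
      push_cast at hμz ⊢
      linear_combination hμz
    rw [this, inner_smul_right, real_inner_self_eq_norm_sq, hsub, norm_smul, norm_cis,
      Real.norm_eq_abs, abs_of_pos hρ]
    have : 0 < μ - 1 := by linarith
    positivity
  have hD₀ : 0 < inner ℝ (cis θ₀) (z t₀ - C.rimPt θ₀) := by
    have h2 : z t₀ - C.rimPt θ₀ = ((μ - 1) / μ) • (A.center - C.rimPt θ₀) := by
      have hμ0 : (μ : ℂ) ≠ 0 := by exact_mod_cast (by linarith : μ ≠ 0)
      simp only [Complex.real_smul] at hμz ⊢
      push_cast at hμz ⊢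
      field_simp
      linear_combination -hμz
    rw [h2, inner_smul_right]
    have : 0 < μ - 1 := by linarith
    positivity
  have hl₀ : 0 < ‖C.rimPt θ₀ - z t₀‖ := by
    rw [norm_pos_iff]
    intro h0
    simp [h0] at hout
  set D₀ := inner ℝ (cis θ₀) (z t₀ - C.rimPt θ₀) with hD₀'
  set l₀ := ‖C.rimPt θ₀ - z t₀‖ with hl₀'
  refine ⟨D₀ / 2, by linarith, ?_⟩
  -- everything that holds when one leg of the flight is close to the original one
  have hgood : ∀ᶠ q : ℝ × ℝ in 𝓝 (θ₀, t₀), z q.2 ∈ A.carrier ∧ z q.2 ∉ C.corners ∧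
      openSegment ℝ (C.rimPt q.1) (z q.2) ⊆ C.openRegion ∧
      inner ℝ (cis q.1) (z q.2 - C.rimPt q.1) ∈ Set.Icc (D₀ / 2) (4 * (D₀ / 2)) ∧
      ‖C.rimPt q.1 - z q.2‖ ∈ Set.Ioo (l₀ / 2) (2 * l₀) ∧
      0 < inner ℝ (cis q.2) (C.rimPt q.1 - z q.2) := by
    have c1 : ∀ᶠ q : ℝ × ℝ in 𝓝 (θ₀, t₀), z q.2 ∈ A.carrier := by
      have : ∀ᶠ t in 𝓝 t₀, t ∈ Set.Icc A.lo A.hi := Icc_mem_nhds ht₀'.1 ht₀'.2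
      have hc : ContinuousAt (fun q : ℝ × ℝ => q.2) (θ₀, t₀) := by fun_prop
      filter_upwards [hc.eventually this] with q hq
      exact ⟨_, hq, rfl⟩
    have c2 : ∀ᶠ q : ℝ × ℝ in 𝓝 (θ₀, t₀), z q.2 ∉ C.corners :=
      ((hcz.comp continuous_snd).continuousAt (x := (θ₀, t₀))).eventually
        ((IsCell.finite_corners (C := C)).isClosed.isOpen_compl.mem_nhds hzc₀)
    have c3 : ∀ᶠ q : ℝ × ℝ in 𝓝 (θ₀, t₀), z q.2 ∈ A.carrier →
        openSegment ℝ (C.rimPt q.1) (z q.2) ⊆ C.openRegion := by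
      have hc : ContinuousAt (fun q : ℝ × ℝ => (q.1, z q.2)) (θ₀, t₀) := by fun_prop
      exact hc.eventually (hC.eventually_openSegment ⟨t₀, ht₀, rfl⟩ hzc₀ hseg₀ hD₀ hout)
    have c4 : ∀ᶠ q : ℝ × ℝ in 𝓝 (θ₀, t₀),
        inner ℝ (cis q.1) (z q.2 - C.rimPt q.1) ∈ Set.Icc (D₀ / 2) (4 * (D₀ / 2)) := by
      have hc : ContinuousAt (fun q : ℝ × ℝ => inner ℝ (cis q.1) (z q.2 - C.rimPt q.1))
        (θ₀, t₀) := by fun_prop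
      exact hc.eventually (Icc_mem_nhds (by simp only [← hD₀']; linarith)
        (by simp only [← hD₀']; linarith))
    have c5 : ∀ᶠ q : ℝ × ℝ in 𝓝 (θ₀, t₀),
        ‖C.rimPt q.1 - z q.2‖ ∈ Set.Ioo (l₀ / 2) (2 * l₀) := by
      have hc : ContinuousAt (fun q : ℝ × ℝ => ‖C.rimPt q.1 - z q.2‖) (θ₀, t₀) := by fun_prop
      exact hc.eventually (Ioo_mem_nhds (by simp only [← hl₀']; linarith)
        (by simp only [← hl₀']; linarith))
    have c6 : ∀ᶠ q : ℝ × ℝ in 𝓝 (θ₀, t₀), 0 < inner ℝ (cis q.2) (C.rimPt q.1 - z q.2) := by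
      have hc : ContinuousAt (fun q : ℝ × ℝ => inner ℝ (cis q.2) (C.rimPt q.1 - z q.2))
        (θ₀, t₀) := by fun_prop
      refine hc.eventually (lt_mem_nhds ?_)
      rw [hsub, real_inner_smul_left] at hout
      exact pos_of_mul_pos_right hout hρ.le
    filter_upwards [c1, c2, c3, c4, c5, c6] with q h1 h2 h3 h4 h5 h6
    exact ⟨h1, h2, h3 h1, h4, h5, h6⟩
  obtain ⟨ε, hε, hgood⟩ := Metric.eventually_nhds_iff.1 hgood
  set η := min (ε / 2) 1 with hη
  have hη0 : 0 < η := lt_min (by linarith) one_pos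
  have hηε : η < ε := (min_le_left _ _).trans_lt (by linarith)
  have hsin : 0 < Real.sin η := Real.sin_pos_of_pos_of_lt_pi hη0
    (by linarith [Real.pi_gt_three, min_le_right (ε / 2) 1])
  -- the sign of the deviation from the law of reflection at the point of the arc at angle `t`
  set g : ℝ → ℝ × ℝ → ℝ := fun t q =>
    ‖C.rimPt q.2 - z t‖ *
      (Real.cos t * (C.rimPt q.1 - z t).im - Real.sin t * (C.rimPt q.1 - z t).re) +
    ‖C.rimPt q.1 - z t‖ *
      (Real.cos t * (C.rimPt q.2 - z t).im - Real.sin t * (C.rimPt q.2 - z t).re) with hg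
  have hg₀ : ∀ t, g t (θ₀, θ₀) =
      2 * ‖C.rimPt θ₀ - z t‖ * (μ * A.radius * Real.sin (t₀ - t)) := by
    intro t
    have e : C.rimPt θ₀ - z t = (μ * A.radius) • cis t₀ - A.radius • cis t := by
      rw [← hsub, mul_smul, ← hsub, ← hμz]
      ring
    simp only [hg, e, cis, Real.sin_sub]
    simp
    ring
  have hnorm : ∀ t, |t - t₀| < ε → 0 < ‖C.rimPt θ₀ - z t‖ := by
    intro t ht
    have := (@hgood (θ₀, t) (by simpa [Prod.dist_eq, Real.dist_eq, hε] using ht)).2.2.2.2.1.1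
    exact lt_trans (by linarith) this
  have s1 : ∀ᶠ q in 𝓝 (θ₀, θ₀), 0 < g (t₀ - η) q := by
    have hc : Continuous fun q => g (t₀ - η) q := by simp only [hg]; fun_prop
    refine hc.continuousAt.eventually (lt_mem_nhds ?_)
    have := hnorm (t₀ - η) (by rwa [show t₀ - η - t₀ = -η by ring, abs_neg, abs_of_pos hη0])
    simp only
    rw [hg₀, show t₀ - (t₀ - η) = η by ring]
    positivity
  have s2 : ∀ᶠ q in 𝓝 (θ₀, θ₀), g (t₀ + η) q < 0 := by
    have hc : Continuous fun q => g (t₀ + η) q := by simp only [hg]; fun_prop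
    refine hc.continuousAt.eventually (gt_mem_nhds ?_)
    have := hnorm (t₀ + η) (by rwa [show t₀ + η - t₀ = η by ring, abs_of_pos hη0])
    simp only
    rw [hg₀, show t₀ - (t₀ + η) = -η by ring, Real.sin_neg]
    have : 0 < 2 * ‖C.rimPt θ₀ - z (t₀ + η)‖ * (μ * A.radius * Real.sin η) := by positivity
    linarith
  filter_upwards [s1, s2, Metric.ball_mem_nhds (θ₀, θ₀) hε] with q h1 h2 hq
  obtain ⟨t, ht, hgt⟩ := intermediate_value_Icc' (by linarith : t₀ - η ≤ t₀ + η)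
    (f := fun t => g t q) (by fun_prop) ⟨h2.le, h1.le⟩
  have htε : |t - t₀| < ε := by
    rw [abs_lt]; constructor <;> linarith [ht.1, ht.2]
  rw [Metric.mem_ball, Prod.dist_eq, max_lt_iff] at hq
  have hq' : |q.1 - θ₀| < ε ∧ |q.2 - θ₀| < ε := hq
  obtain ⟨a1, a2, a3, a4, a5, a6⟩ := @hgood (q.1, t) (by
    simp only [Prod.dist_eq, Real.dist_eq, max_lt_iff]; exact ⟨hq'.1, htε⟩)
  obtain ⟨-, -, b3, b4, b5, b6⟩ := @hgood (q.2, t) (by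
    simp only [Prod.dist_eq, Real.dist_eq, max_lt_iff]; exact ⟨hq'.2, htε⟩)
  simp only at a1 a2 a3 a4 a5 a6 b3 b4 b5 b6
  refine ⟨z t, a1, a2, a3, openSegment_symm ℝ (C.rimPt q.2) (z t) ▸ b3, a4, b4,
    ‖C.rimPt q.2 - z t‖ / ‖C.rimPt q.1 - z t‖, ⟨?_, ?_⟩, ?_⟩
  · rw [le_div_iff₀ (lt_trans (by linarith) a5.1)]
    linarith [a5.2, b5.1]
  · rw [div_le_iff₀ (lt_trans (by linarith) a5.1)]
    linarith [a5.1, b5.2]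
  · have := smul_specular_eq hρ a6 b6 hgt
    rwa [neg_sub, ← hsub] at this

end CellShape


namespace CellShape

/-! ### Links: flights from disk to disk -/

variable {C : CellShape} {N : ℕ} {D : Fin N → Prop}

/-- The point of the chain whose coordinates relative to cell `ℓ` are `q`. -/
noncomputable def shift (C : CellShape) (ℓ : ℕ) (q : ℂ) : ℂ := q + ((ℓ * C.width : ℝ) : ℂ)

@[simp] theorem loc_shift (ℓ : ℕ) (q : ℂ) : C.loc ℓ (C.shift ℓ q) = q := by simp [loc, shift]

theorem loc_shift_add (ℓ : ℕ) (q w : ℂ) : C.loc ℓ (C.shift ℓ q + w) = q + w := by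
  simp [loc, shift]
  ring

/-- The point of the rim of disk `X.1` at angle `X.2`. -/
noncomputable def rim (C : CellShape) (X : Fin N × ℝ) : ℂ := C.shift X.1 (C.rimPt X.2)

theorem onDisk_rim (hC : C.IsCell) (X : Fin N × ℝ) : C.OnDisk X.1 (C.rim X) := by
  rw [OnDisk, rim, loc_shift]
  exact dist_circlePt hC.diskRadius_pos X.2

theorem diskNormal_rim (hC : C.IsCell) (X : Fin N × ℝ) :
    C.diskNormal X.1 (C.rim X) = cis X.2 := by
  rw [diskNormal, rim, loc_shift, rimPt_sub, smul_smul, inv_mul_cancel₀ hC.diskRadius_pos.ne',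
    one_smul]

/-- A free flight inside one cell. -/
theorem Travel.flight (hC : C.IsCell) (ℓ : Fin N) {p z v : ℂ} {T : ℝ} (hT : 0 < T)
    (hv : T • v = z - p) (hseg : openSegment ℝ p z ⊆ C.openRegion) (s : ℝ) :
    C.Travel D s (s + T) (C.shift ℓ p) v (C.shift ℓ z) v := by
  refine Travel.straight ?_ fun t h1 h2 => hC.passes_free ℓ ?_ v
  · rw [add_sub_cancel_left, hv, shift, shift]
    ring
  · rw [loc_shift_add]
    have e : (t - s) • v = ((t - s) / T) • (z - p) := by
      rw [← hv, smul_smul, div_mul_cancel₀ _ hT.ne']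
    rw [e]
    exact hseg (mem_openSegment_add (div_pos (by linarith) hT)
      ((div_lt_one hT).2 (by linarith)))

/-- A particle can fly from the rim point `X` to the rim point `Y`, hitting in between only disks
`ℓ` with `D ℓ`, with an arbitrary outgoing normal velocity `a`. The time needed is at most `K / a`,
and the normal velocity on arrival is `k * a`, where `k` depends only on the route. The tangential
velocities are dictated by the route. -/
def Link (C : CellShape) (D : Fin N → Prop) (K : ℝ) (X Y : Fin N × ℝ) : Prop :=
  ∃ k, K⁻¹ ≤ k ∧ k ≤ K ∧ ∀ a > 0, ∃ T, 0 < T ∧ T ≤ K / a ∧ ∀ s, ∃ v v',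
    C.Travel D s (s + T) (C.rim X) v (C.rim Y) v' ∧
    inner ℝ (cis X.2) v = a ∧ inner ℝ (cis Y.2) v' = -(k * a)

/-- Flights can be joined at a disk: any outgoing direction is possible there, as the angular
velocity of the disk is at our disposal. -/
theorem Travel.trans_rim (hC : C.IsCell) {s t u : ℝ} {Y : Fin N × ℝ} {p v w w' p' v' : ℂ}
    (hst : s < t) (htu : t < u) (hY : D Y.1) (h₁ : C.Travel D s t p v (C.rim Y) w)
    (h₂ : C.Travel D t u (C.rim Y) w' p' v') (hw' : 0 < inner ℝ (cis Y.2) w')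
    (hw : inner ℝ (cis Y.2) w = -inner ℝ (cis Y.2) w') : C.Travel D s u p v p' v' := by
  have hd := onDisk_rim hC Y
  refine h₁.trans hst htu h₂ (hC.passes_disk Y.1 hd ?_ ?_) fun ℓ hℓ => ?_
  · rw [diskNormal_rim hC, hw]
    linarith
  · rw [diskNormal_rim hC, hw, neg_neg]
  · rwa [hC.eq_of_onDisk hd hℓ]

theorem Link.trans (hC : C.IsCell) {K K' : ℝ} (hK : 0 < K) (hK' : 0 < K') {X Y Z : Fin N × ℝ}
    (hY : D Y.1) (h₁ : C.Link D K X Y) (h₂ : C.Link D K' Y Z) :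
    C.Link D (K + K * K') X Z := by
  obtain ⟨k, hk1, hk2, h₁⟩ := h₁
  obtain ⟨k', hk1', hk2', h₂⟩ := h₂
  have hk : 0 < k := (inv_pos.2 hK).trans_le hk1
  have hk' : 0 < k' := (inv_pos.2 hK').trans_le hk1'
  have hKK : 0 < K * K' := mul_pos hK hK'
  refine ⟨k' * k, ?_, ?_, fun a ha => ?_⟩
  · calc (K + K * K')⁻¹ ≤ (K * K')⁻¹ := inv_anti₀ hKK (by linarith)
      _ = K'⁻¹ * K⁻¹ := by rw [mul_inv, mul_comm]
      _ ≤ k' * k := mul_le_mul hk1' hk1 (inv_pos.2 hK).le hk'.le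
  · calc k' * k ≤ K' * K := mul_le_mul hk2' hk2 hk.le hK'.le
      _ ≤ K + K * K' := by linarith [mul_comm K K']
  · obtain ⟨T, hT, hTK, h₁⟩ := h₁ a ha
    obtain ⟨T', hT', hTK', h₂⟩ := h₂ (k * a) (mul_pos hk ha)
    refine ⟨T + T', by linarith, ?_, fun s => ?_⟩
    · have : K' / (k * a) ≤ K * K' / a := by
        rw [div_le_div_iff₀ (mul_pos hk ha) ha]
        have : 1 ≤ K * k := by
          have := mul_le_mul_of_nonneg_left hk1 hK.le
          rwa [mul_inv_cancel₀ hK.ne'] at this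
        nlinarith [mul_pos hK' ha]
      rw [add_div]
      linarith
    · obtain ⟨v, w, hv, hva, hwa⟩ := h₁ s
      obtain ⟨w', v', hv', hwa', hva'⟩ := h₂ (s + T)
      refine ⟨v, v', ?_, hva, by rw [hva', mul_assoc]⟩
      rw [← add_assoc]
      refine hv.trans_rim hC (by linarith) (by linarith) hY hv' ?_ ?_
      · rw [hwa']; positivity
      · rw [hwa, hwa']

theorem specular_smul_right (c : ℝ) (n v : ℂ) : specular n (c • v) = c • specular n v := by
  simp only [specular, inner_smul_right, smul_sub, smul_smul]
  congr 2
  ring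

/-- Near an illuminated point, any two points of the rim are linked, with uniform bounds. -/
theorem IsCell.eventually_link (hC : C.IsCell) {k : Fin C.numArcs} {θ₀ : ℝ}
    (h : θ₀ ∈ C.illuminated k) : ∃ K : ℝ, 0 < K ∧ ∀ᶠ q : ℝ × ℝ in 𝓝 (θ₀, θ₀),
      ∀ (N : ℕ) (D : Fin N → Prop) (ℓ : Fin N), C.Link D K (ℓ, q.1) (ℓ, q.2) := by
  obtain ⟨B, hB, hev⟩ := hC.exists_hop h
  refine ⟨16 + 20 * B, by linarith, ?_⟩
  filter_upwards [hev] with q hq N D ℓ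
  obtain ⟨z, hz, hzc, hseg₁, hseg₂, ⟨hD₁, hD₁'⟩, ⟨hD₂, hD₂'⟩, s, ⟨hs, hs'⟩, hsp⟩ := hq
  set n := z - (C.arc k).center
  set D₁ := inner ℝ (cis q.1) (z - C.rimPt q.1)
  set D₂ := inner ℝ (cis q.2) (z - C.rimPt q.2) with hD₂def
  have hs0 : 0 < s := lt_of_lt_of_le (by norm_num) hs
  have hD₁0 : 0 < D₁ := by linarith
  have hD₂0 : 0 < D₂ := by linarith
  refine ⟨D₂ / (D₁ * s), ?_, ?_, fun a ha => ⟨D₁ / a + D₁ * s / a, by positivity, ?_, fun t =>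
    ⟨(a / D₁) • (z - C.rimPt q.1), (a / (D₁ * s)) • (C.rimPt q.2 - z), ?_, ?_, ?_⟩⟩⟩
  · calc (16 + 20 * B)⁻¹ ≤ (16 : ℝ)⁻¹ := inv_anti₀ (by norm_num) (by linarith)
      _ ≤ D₂ / (D₁ * s) := by
        rw [le_div_iff₀ (by positivity)]
        nlinarith
  · calc D₂ / (D₁ * s) ≤ 16 := by
          rw [div_le_iff₀ (by positivity)]
          nlinarith
      _ ≤ 16 + 20 * B := by linarith
  · rw [← add_div, div_le_div_iff_of_pos_right ha]
    nlinarith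
  · have hloc : C.loc ℓ (C.shift ℓ z) = z := loc_shift _ _
    obtain ⟨hpass, hnd⟩ := hC.passes_wall ℓ (p := C.shift ℓ z) (k := k) (by rwa [hloc])
      (by rwa [hloc]) ((a / D₁) • (z - C.rimPt q.1))
    rw [← add_assoc]
    refine (Travel.flight hC ℓ (by positivity) ?_ hseg₁ t).trans
      (lt_add_of_pos_right _ (by positivity)) (lt_add_of_pos_right _ (by positivity))
      (Travel.flight hC ℓ (by positivity) ?_ hseg₂ (t + D₁ / a)) ?_
      fun ℓ' h' => (hnd ℓ' h').elim
    · rw [smul_smul, div_mul_div_cancel₀ ha.ne', div_self hD₁0.ne', one_smul]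
    · rw [smul_smul, div_mul_div_cancel₀ ha.ne', div_self (by positivity), one_smul]
    · convert hpass using 1
      rw [hloc, specular_smul_right, hsp, smul_smul]
      congr 1
      field_simp
  · rw [inner_smul_right]
    exact div_mul_cancel₀ a hD₁0.ne'
  · rw [inner_smul_right, ← neg_sub z, inner_neg_right, ← hD₂def]
    field_simp

/-- In a 1-controllable cell a particle can walk around the disk. -/
theorem IsCell.exists_link (hC : C.IsCell) (hctrl : C.OneControllable) {ℓ : Fin N} (hℓ : D ℓ)
    (θ θ' : ℝ) : ∃ K : ℝ, 0 < K ∧ C.Link D K (ℓ, θ) (ℓ, θ') := by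
  refine PreconnectedSpace.induction₂' (fun θ θ' => ∃ K : ℝ, 0 < K ∧ C.Link D K (ℓ, θ) (ℓ, θ'))
    (fun θ₀ => ?_) ⟨?_⟩ θ θ'
  · obtain ⟨k, hk⟩ := hctrl θ₀
    obtain ⟨K, hK, h⟩ := hC.eventually_link hk
    have c1 : ContinuousAt (fun θ : ℝ => (θ₀, θ)) θ₀ := by fun_prop
    have c2 : ContinuousAt (fun θ : ℝ => (θ, θ₀)) θ₀ := by fun_prop
    filter_upwards [c1.eventually h, c2.eventually h] with θ h1 h2
    exact ⟨⟨K, hK, h1 N D ℓ⟩, K, hK, h2 N D ℓ⟩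
  · rintro a b c ⟨K, hK, h⟩ ⟨K', hK', h'⟩
    exact ⟨_, by positivity, h.trans hC hK hK' hℓ h'⟩

end CellShape


namespace CellShape

/-! ### The way from a bath to a disk -/

variable {C : CellShape} {N : ℕ} {D : Fin N → Prop}

/-- The sign of the horizontal direction that leads from the bath into the chain. -/
noncomputable def _root_.Side.sign : Side → ℝ
  | Side.left => 1
  | Side.right => -1

/-- The polar angle of the horizontal direction that leads from the bath into the chain. -/
noncomputable def _root_.Side.ang : Side → ℝ
  | Side.left => 0
  | Side.right => Real.pi

/-- The `d`-th cell, counted from the bath on the given side; this is an involution, so `S.cell ℓ`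
is also the depth of cell `ℓ`. -/
def _root_.Side.cell : Side → Fin N → Fin N
  | Side.left, d => d
  | Side.right, d => d.rev

@[simp] theorem _root_.Side.cell_cell (S : Side) (d : Fin N) : S.cell (S.cell d) = d := by
  cases S <;> simp [Side.cell]

theorem _root_.Side.sign_eq (S : Side) : S.sign = 1 ∨ S.sign = -1 := by
  cases S <;> simp [Side.sign]

theorem _root_.Side.sign_mul_self (S : Side) : S.sign * S.sign = 1 := by
  cases S <;> simp [Side.sign]

theorem _root_.Side.abs_sign (S : Side) : |S.sign| = 1 := by
  cases S <;> simp [Side.sign]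

variable (S : Side)

theorem cis_ang_add (φ : ℝ) : cis (S.ang + φ) = S.sign * cis φ := by
  cases S
  · simp [Side.ang, Side.sign]
  · apply Complex.ext <;> simp [Side.ang, Side.sign, cis, Real.cos_add, Real.sin_add]

theorem cis_ang_add_pi : cis (S.ang + Real.pi) = ((-S.sign : ℝ) : ℂ) := by
  rw [cis_ang_add]
  apply Complex.ext <;> simp [cis]

theorem inner_cis_ang_add (φ V w : ℝ) :
    inner ℝ (cis (S.ang + φ)) (S.sign * (⟨V, w⟩ : ℂ)) = V * Real.cos φ + w * Real.sin φ := by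
  have := S.sign_mul_self
  rw [cis_ang_add]
  simp [Complex.inner, cis]
  linear_combination (V * Real.cos φ + w * Real.sin φ) * this

theorem inner_facing (V w : ℝ) :
    inner ℝ (cis (S.ang + Real.pi)) (S.sign * (⟨V, w⟩ : ℂ)) = -V := by
  rw [inner_cis_ang_add]
  simp

theorem rim_ang_add (d : Fin N) (φ : ℝ) : C.rim (S.cell d, S.ang + φ) =
    C.shift (S.cell d) (C.diskCenter + S.sign * (C.diskRadius * cis φ)) := by
  have := rimPt_sub (C := C) (S.ang + φ)
  rw [rim, ← sub_add_cancel (C.rimPt (S.ang + φ)) C.diskCenter, this, cis_ang_add,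
    Complex.real_smul]
  congr 1
  ring

/-- The coordinates of a point relative to two neighbouring cells. -/
theorem shift_succ {d d' : Fin N} (h : (d' : ℕ) = d + 1) (q : ℂ) :
    C.shift (S.cell d') q = C.shift (S.cell d) (q + S.sign * C.width) := by
  cases S
  · simp only [Side.cell, Side.sign, shift, h]
    push_cast
    ring
  · have : ((Fin.rev d : Fin N) : ℕ) = (Fin.rev d' : Fin N) + 1 := by
      rw [Fin.val_rev, Fin.val_rev]
      omega
    simp only [Side.cell, Side.sign, shift, this]
    push_cast
    ring

theorem IsCell.wedge_openRegion (hC : C.IsCell) {e x y : ℝ} (he : e = 1 ∨ e = -1)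
    (hx : C.diskRadius < x) (hxL : x < C.width / 2)
    (hy : |y| < 2 * C.halfOpening / C.width * x) :
    C.diskCenter + e * (⟨x, y⟩ : ℂ) ∈ C.openRegion := by
  have hr := hC.diskRadius_pos
  refine ⟨hC.wedge he (hr.trans hx) hxL hy, ?_⟩
  have he' : ‖(e : ℂ)‖ = 1 := by rcases he with rfl | rfl <;> simp
  rw [Metric.mem_closedBall, not_le, dist_eq_norm, add_sub_cancel_left, norm_mul, he', one_mul]
  calc C.diskRadius < x := hx
    _ ≤ |x| := le_abs_self x
    _ ≤ _ := Complex.abs_re_le_norm (⟨x, y⟩ : ℂ)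

/-- The way from the bath to the first disk. Slightly slanted directions are possible, and the
particle can be as fast as one likes. -/
theorem IsCell.approach_first (hC : C.IsCell) {d : Fin N} (hd : (d : ℕ) = 0) :
    ∃ K > 0, ∃ η > 0, ∀ V > 0, ∀ w : ℝ, |w| ≤ η * V → ∃ T, 0 < T ∧ T ≤ K / V ∧ ∀ s, ∃ p v,
      p ∈ C.bath N S ∧ |p.im| < C.halfOpening ∧ S.Inward v ∧
      C.Travel D s (s + T) p v (C.rim (S.cell d, S.ang + Real.pi)) (S.sign * (⟨V, w⟩ : ℂ)) := by
  have hL := hC.width_pos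
  have ha := hC.halfOpening_pos
  have hr := hC.diskRadius_pos
  have hrL := hC.radius_lt
  refine ⟨C.width / 2 - C.diskRadius, by linarith, 2 * C.halfOpening / C.width, by positivity,
    fun V hV w hw => ⟨(C.width / 2 - C.diskRadius) / V, div_pos (by linarith) hV, le_rfl,
    fun s => ?_⟩⟩
  set r := C.diskRadius
  set T := (C.width / 2 - r) / V with hT
  have hT0 : 0 < T := div_pos (by linarith) hV
  have hTV : T * V = C.width / 2 - r := div_mul_cancel₀ _ hV.ne'
  clear_value T
  have hTw : T * |w| < C.halfOpening := by
    calc T * |w| ≤ T * (2 * C.halfOpening / C.width * V) := by gcongr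
      _ = 2 * C.halfOpening / C.width * (C.width / 2 - r) := by rw [← hTV]; ring
      _ < 2 * C.halfOpening / C.width * (C.width / 2) := by gcongr; linarith
      _ = C.halfOpening := by field_simp
  have hsign := S.abs_sign
  have himp : ∀ x y : ℝ, (C.shift (S.cell d) (C.diskCenter + S.sign * (⟨x, y⟩ : ℂ))).im =
      S.sign * y := by
    intro x y; simp [shift, diskCenter]
  refine ⟨C.shift (S.cell d) (C.diskCenter + S.sign * (⟨-(C.width / 2), -(T * w)⟩ : ℂ)),
    S.sign * (⟨V, w⟩ : ℂ), ?_, ?_, ?_, ?_⟩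
  · have him : |S.sign * -(T * w)| ≤ C.halfOpening := by
      rw [abs_mul, hsign, one_mul, abs_neg, abs_mul, abs_of_pos hT0]
      exact hTw.le
    cases S
    · refine ⟨?_, by rwa [himp]⟩
      simp [shift, diskCenter, Side.sign, Side.cell, hd]
    · refine ⟨?_, by rwa [himp]⟩
      have hN : ((N - (0 + 1) : ℕ) : ℝ) = N - 1 := by
        rw [Nat.cast_sub (by have := d.2; omega)]; simp
      simp only [shift, diskCenter, Side.sign, Side.cell, Fin.val_rev, hd, hN]
      simp
      ring
  · rw [himp, abs_mul, hsign, one_mul, abs_neg, abs_mul, abs_of_pos hT0]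
    exact hTw
  · cases S <;> simp [Side.Inward, Side.sign, hV]
  · have hpos : ∀ t, C.shift (S.cell d) (C.diskCenter + S.sign *
        (⟨-(C.width / 2), -(T * w)⟩ : ℂ)) + (t - s) • (S.sign * (⟨V, w⟩ : ℂ)) =
        C.shift (S.cell d) (C.diskCenter + ((-S.sign : ℝ) : ℂ) *
          (⟨r + (s + T - t) * V, (s + T - t) * w⟩ : ℂ)) := by
      intro t
      apply Complex.ext <;> simp [shift]
      · linear_combination S.sign * hTV
      · ring
    have hneg : -S.sign = 1 ∨ -S.sign = -1 := by
      cases S <;> simp [Side.sign]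
    refine Travel.straight ?_ fun t h1 h2 => ?_
    · have := hpos (s + T)
      rw [this, rim_ang_add]
      congr 2
      apply Complex.ext <;> simp [cis, r]
    · have := hpos t
      rw [this]
      refine hC.passes_free (S.cell d) ?_ _
      rw [loc_shift]
      have hσ : 0 < s + T - t := by linarith
      have hσV : (s + T - t) * V < T * V := by
        gcongr; linarith
      refine hC.wedge_openRegion hneg ?_ (by linarith) ?_
      · have := mul_pos hσ hV
        show r < _
        linarith
      · rw [abs_mul, abs_of_pos hσ]
        calc (s + T - t) * |w| ≤ (s + T - t) * (2 * C.halfOpening / C.width * V) := by gcongr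
          _ = 2 * C.halfOpening / C.width * ((s + T - t) * V) := by ring
          _ < 2 * C.halfOpening / C.width * (r + (s + T - t) * V) := by gcongr; linarith

/-- The straight flight from disk `d` through the opening to the next disk, where the particle
arrives at the point facing disk `d`. -/
theorem IsCell.travel_next (hC : C.IsCell) {d d' : Fin N} (hd : (d' : ℕ) = d + 1)
    {V w φ T : ℝ} (hV : 0 < V) (hT : 0 < T)
    (h1 : C.diskRadius * Real.cos φ = C.width - C.diskRadius - T * V)
    (h2 : C.diskRadius * Real.sin φ = -(T * w)) (hcos : 1 / 2 ≤ Real.cos φ)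
    (hsin : |Real.sin φ| < C.halfOpening / C.width)
    (hout : 0 < V * Real.cos φ + w * Real.sin φ) (s : ℝ) :
    C.Travel D s (s + T) (C.rim (S.cell d, S.ang + φ)) (S.sign * (⟨V, w⟩ : ℂ))
      (C.rim (S.cell d', S.ang + Real.pi)) (S.sign * (⟨V, w⟩ : ℂ)) := by
  have hL := hC.width_pos
  have ha := hC.halfOpening_pos
  have hr := hC.diskRadius_pos
  have hrL := hC.radius_lt
  have hsign := S.abs_sign
  set r := C.diskRadius with hrdef
  have hpos : ∀ t, C.rim (S.cell d, S.ang + φ) + (t - s) • (S.sign * (⟨V, w⟩ : ℂ)) =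
      C.shift (S.cell d) (C.diskCenter + S.sign *
        (⟨C.width - r - (s + T - t) * V, -((s + T - t) * w)⟩ : ℂ)) := by
    intro t
    rw [rim_ang_add]
    apply Complex.ext <;> simp [shift, cis]
    · linear_combination S.sign * h1
    · linear_combination S.sign * h2
  have hpos' : ∀ t, C.rim (S.cell d, S.ang + φ) + (t - s) • (S.sign * (⟨V, w⟩ : ℂ)) =
      C.shift (S.cell d') (C.diskCenter + ((-S.sign : ℝ) : ℂ) *
        (⟨r + (s + T - t) * V, (s + T - t) * w⟩ : ℂ)) := by
    intro t
    have := hpos t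
    rw [this, shift_succ S hd]
    congr 1
    apply Complex.ext
    · simp; ring
    · simp
  refine Travel.straight ?_ fun t ht1 ht2 => ?_
  · have := hpos' (s + T)
    rw [this, rim_ang_add]
    congr 2
    apply Complex.ext <;> simp [cis, hrdef]
  have hσ : 0 < s + T - t := by linarith
  have hy : |(s + T - t) * w| < C.halfOpening / C.width * r := by
    rw [abs_mul, abs_of_pos hσ]
    calc (s + T - t) * |w| ≤ T * |w| := by gcongr; linarith
      _ = |r * Real.sin φ| := by rw [h2, abs_neg, abs_mul, abs_of_pos hT]
      _ = |Real.sin φ| * r := by rw [abs_mul, abs_of_pos hr, mul_comm]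
      _ < _ := by gcongr
  have hσV := mul_pos hσ hV
  have hσT : (s + T - t) * V ≤ T * V := by
    gcongr; linarith
  have haL : 0 < C.halfOpening / C.width := by positivity
  rcases lt_trichotomy (C.width - r - (s + T - t) * V) (C.width / 2) with hx | hx | hx
  · have hreg : C.loc (S.cell d) (C.rim (S.cell d, S.ang + φ) +
        (t - s) • (S.sign * (⟨V, w⟩ : ℂ))) ∈ C.openRegion := by
      refine ⟨?_, ?_⟩
      · rw [hpos t, loc_shift]
        refine hC.wedge S.sign_eq ?_ hx ?_
        · nlinarith
        · rw [abs_neg]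
          refine hy.trans_le ?_
          rw [mul_div_assoc, mul_comm 2, mul_assoc]
          gcongr
          nlinarith
      · rw [rim, loc_shift_add, Metric.mem_closedBall, not_le]
        have := lt_dist_of_inner_pos (o := C.diskCenter) (z := C.rimPt (S.ang + φ))
          (w := (t - s) • (S.sign * (⟨V, w⟩ : ℂ))) (by
            rw [rimPt_sub, real_inner_smul_left, inner_smul_right, inner_cis_ang_add]
            have : 0 < t - s := by linarith
            positivity)
        rwa [show dist (C.rimPt (S.ang + φ)) C.diskCenter = C.diskRadius from
          dist_circlePt hr _] at this
    exact hC.passes_free _ hreg _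
  · have him : |-((s + T - t) * w)| < C.halfOpening := by
      rw [abs_neg]
      refine hy.trans ?_
      rw [div_mul_eq_mul_div, div_lt_iff₀ hL]
      gcongr
      linarith
    rw [hpos t]
    have hd'N := d'.2
    have him' : |(C.shift (S.cell d) (C.diskCenter + S.sign *
        (⟨C.width - r - (s + T - t) * V, -((s + T - t) * w)⟩ : ℂ))).im| < C.halfOpening := by
      have : (C.shift (S.cell d) (C.diskCenter + S.sign *
        (⟨C.width - r - (s + T - t) * V, -((s + T - t) * w)⟩ : ℂ))).im =
          S.sign * -((s + T - t) * w) := by simp [shift, diskCenter]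
      rwa [this, abs_mul, hsign, one_mul]
    cases S
    · refine hC.passes_opening (k := d + 1) (by omega) (by omega) ?_ him' _
      simp [shift, diskCenter, Side.sign, Side.cell, hx]
      ring
    · refine hC.passes_opening (k := (Fin.rev d : Fin N)) ?_ (Fin.rev d).2 ?_ him' _
      · rw [Fin.val_rev]; omega
      · simp [shift, diskCenter, Side.sign, Side.cell, hx]
  · rw [hpos' t]
    refine hC.passes_free (S.cell d') ?_ _
    rw [loc_shift]
    have hneg : -S.sign = 1 ∨ -S.sign = -1 := by
      cases S <;> simp [Side.sign]
    refine hC.wedge_openRegion hneg (by show r < _; linarith) (by linarith) (hy.trans_le ?_)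
    rw [mul_div_assoc, mul_comm 2, mul_assoc]
    gcongr
    linarith

/-- A ray of small slope hits a circle of radius `r`, from whose rim it starts at distance `G`,
close to the point facing the origin of the ray. -/
theorem exists_landing {r G : ℝ} (hr : 0 < r) (hG : 0 < G) {U : Set ℝ} (hU : U ∈ 𝓝 (0 : ℝ)) :
    ∃ η > 0, ∀ V > 0, ∀ w : ℝ, |w| ≤ η * V → ∃ φ ∈ U, ∃ T, 0 < T ∧ T ≤ (G + r) / V ∧
      r * Real.cos φ = G + r - T * V ∧ r * Real.sin φ = -(T * w) := by
  obtain ⟨ε, hε, hεU⟩ := Metric.eventually_nhds_iff.1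
    (Real.continuous_arcsin.continuousAt.eventually_mem (x := 0) (by rwa [Real.arcsin_zero]))
  set η := min 1 (ε / 2) * (r / (G + r)) with hη
  have hm : 0 < min 1 (ε / 2) := lt_min one_pos (by linarith)
  have hη0 : 0 < η := by positivity
  have hηG : η * (G + r) = min 1 (ε / 2) * r := by rw [hη]; field_simp
  refine ⟨η, hη0, fun V hV w hw => ?_⟩
  have hle : G / V ≤ (G + r) / V := by gcongr; linarith
  have hTw : ∀ T, 0 ≤ T → T ≤ (G + r) / V → |T * w| ≤ min 1 (ε / 2) * r := by
    intro T hT0 hT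
    rw [abs_mul, abs_of_nonneg hT0]
    calc T * |w| ≤ (G + r) / V * (η * V) := by gcongr
      _ = η * (G + r) := by field_simp
      _ = _ := hηG
  obtain ⟨T, hT, hfT⟩ := intermediate_value_Icc' hle
    (f := fun T => (G + r - T * V) ^ 2 + (T * w) ^ 2) (by fun_prop)
    (show r ^ 2 ∈ _ from by
      constructor
      · have := hTw ((G + r) / V) (by positivity) le_rfl
        rw [div_mul_cancel₀ _ hV.ne', sub_self]
        have h1 : |(G + r) / V * w| ≤ |r| := by
          rw [abs_of_pos hr]
          nlinarith [min_le_left 1 (ε / 2)]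
        nlinarith [sq_le_sq.2 h1]
      · show r ^ 2 ≤ (G + r - G / V * V) ^ 2 + (G / V * w) ^ 2
        rw [div_mul_cancel₀ _ hV.ne']
        nlinarith [sq_nonneg (G / V * w)])
  have hT0 : 0 < T := (div_pos hG hV).trans_le hT.1
  have hTV : T * V ≤ G + r := by
    have := hT.2
    rwa [le_div_iff₀ hV] at this
  have hbd := hTw T hT0.le hT.2
  have hq : |-(T * w) / r| ≤ min 1 (ε / 2) := by
    rw [abs_div, abs_neg, abs_of_pos hr, div_le_iff₀ hr]
    exact hbd
  have hq1 := abs_le.1 (hq.trans (min_le_left _ _))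
  refine ⟨Real.arcsin (-(T * w) / r), hεU ?_, T, hT0, hT.2, ?_, ?_⟩
  · rw [Real.dist_eq, sub_zero]
    linarith [hq.trans (min_le_right _ _)]
  · rw [Real.cos_arcsin]
    have : 1 - (-(T * w) / r) ^ 2 = ((G + r - T * V) / r) ^ 2 := by
      simp only at hfT
      field_simp
      linarith
    rw [this, Real.sqrt_sq (div_nonneg (by linarith) hr.le)]
    field_simp
  · rw [Real.sin_arcsin hq1.1 hq1.2]
    field_simp

theorem IsCell.link_next (hC : C.IsCell) {d d' : Fin N} (hd : (d' : ℕ) = d + 1) :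
    ∃ K > 0, C.Link D K (S.cell d, S.ang) (S.cell d', S.ang + Real.pi) := by
  have hL := hC.width_pos
  have ha := hC.halfOpening_pos
  have hr := hC.diskRadius_pos
  have hrL := hC.radius_lt
  have hK : 1 ≤ 1 + (C.width - 2 * C.diskRadius) := by linarith
  refine ⟨1 + (C.width - 2 * C.diskRadius), by linarith, 1, inv_le_one_of_one_le₀ hK, hK,
    fun a ha' => ⟨(C.width - 2 * C.diskRadius) / a, div_pos (by linarith) ha', ?_, fun s =>
    ⟨S.sign * (⟨a, 0⟩ : ℂ), S.sign * (⟨a, 0⟩ : ℂ), ?_, ?_, ?_⟩⟩⟩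
  · gcongr
    linarith
  · have := hC.travel_next (D := D) S hd (V := a) (w := 0) (φ := 0)
      (T := (C.width - 2 * C.diskRadius) / a) ha' (div_pos (by linarith) ha')
      (by rw [div_mul_cancel₀ _ ha'.ne', Real.cos_zero]; ring) (by simp) (by norm_num)
      (by rw [Real.sin_zero, abs_zero]; positivity) (by simpa using ha') s
    rwa [add_zero] at this
  · have := inner_cis_ang_add S 0 a 0
    simpa using this
  · rw [inner_facing, one_mul]

/-- In a chain of 1-controllable cells, a particle can go from the first disk to any other one. -/
theorem IsCell.exists_link_of_first (hC : C.IsCell) (hctrl : C.OneControllable) {d₀ : Fin N}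
    (hd₀ : (d₀ : ℕ) = 0) (θ₀ : ℝ) (m : ℕ) : ∀ d : Fin N, (d : ℕ) = m →
    (∀ ℓ, S.cell ℓ ≤ d → D ℓ) → ∀ θ, ∃ K > 0, C.Link D K (S.cell d₀, θ₀) (S.cell d, θ) := by
  induction m with
  | zero =>
    intro d hd hD θ
    obtain rfl : d = d₀ := Fin.ext (hd.trans hd₀.symm)
    exact hC.exists_link hctrl (hD _ (by simp)) θ₀ θ
  | succ m ih =>
    intro d hd hD θ
    have hm : m < N := by have := d.2; omega
    have hle : (⟨m, hm⟩ : Fin N) ≤ d := Fin.le_def.2 (by simp only; omega)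
    obtain ⟨K₁, hK₁, h₁⟩ := ih ⟨m, hm⟩ rfl (fun ℓ hℓ => hD ℓ (hℓ.trans hle)) S.ang
    obtain ⟨K₂, hK₂, h₂⟩ := hC.link_next (D := D) S (d := ⟨m, hm⟩) (d' := d) hd
    obtain ⟨K₃, hK₃, h₃⟩ := hC.exists_link hctrl (D := D) (ℓ := S.cell d) (hD _ (by simp))
      (S.ang + Real.pi) θ
    have h₁₂ := h₁.trans hC hK₁ hK₂ (hD _ (by simpa using hle)) h₂
    exact ⟨_, by positivity, h₁₂.trans hC (by positivity) hK₃ (hD _ (by simp)) h₃⟩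

/-- A fast particle can go from the bath to disk `d`, arriving almost perpendicularly, with an
arbitrary tangential velocity `w` which is small compared to the normal velocity `V`. It hits only
the disks in front of disk `d`, and the time it takes is `O(1 / V)`. -/
theorem IsCell.approach (hC : C.IsCell) (hctrl : C.OneControllable) (d : Fin N) :
    ∃ K > 0, ∃ η > 0, ∀ V > 0, ∀ w : ℝ, |w| ≤ η * V → ∃ T, 0 < T ∧ T ≤ K / V ∧ ∀ s, ∃ p v,
      p ∈ C.bath N S ∧ |p.im| < C.halfOpening ∧ S.Inward v ∧
      C.Travel (fun ℓ : Fin N => S.cell ℓ < d) s (s + T) p v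
        (C.rim (S.cell d, S.ang + Real.pi)) (S.sign * (⟨V, w⟩ : ℂ)) := by
  rcases Nat.eq_zero_or_pos (d : ℕ) with hd | hd
  · exact hC.approach_first S hd
  have hdN := d.2
  have hL := hC.width_pos
  have ha := hC.halfOpening_pos
  have hr := hC.diskRadius_pos
  have hrL := hC.radius_lt
  set d₀ : Fin N := ⟨0, by omega⟩ with hd₀
  set b : Fin N := ⟨d - 1, by omega⟩ with hb
  have hbd : (d : ℕ) = b + 1 := by simp only [hb]; omega
  have hblt : b < d := Fin.lt_def.2 (by omega)
  set D : Fin N → Prop := fun ℓ => S.cell ℓ < d with hD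
  obtain ⟨K₀, hK₀, η₀, hη₀, h₀⟩ := hC.approach_first (D := D) S (d := d₀) rfl
  obtain ⟨K₁, hK₁, h₁⟩ := hC.exists_link_of_first (D := D) S hctrl (d₀ := d₀) rfl
    (S.ang + Real.pi) b b rfl (fun ℓ hℓ => hℓ.trans_lt hblt) S.ang
  obtain ⟨k, hk⟩ := hctrl S.ang
  obtain ⟨K₂, hK₂, h₂⟩ := hC.eventually_link hk
  set K := K₁ + K₁ * K₂ with hK
  have hKpos : 0 < K := by positivity
  have hlink : ∀ᶠ φ : ℝ in 𝓝 0, C.Link D K (S.cell d₀, S.ang + Real.pi) (S.cell b, S.ang + φ) := by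
    have hc : ContinuousAt (fun φ : ℝ => (S.ang, S.ang + φ)) 0 := by fun_prop
    have hev := hc.eventually (by simpa using h₂)
    filter_upwards [hev] with φ hφ
    exact h₁.trans hC hK₁ hK₂ (by simpa [hD] using hblt) (hφ N D (S.cell b))
  have hcos : ∀ᶠ φ : ℝ in 𝓝 0, 1 / 2 < Real.cos φ :=
    Real.continuous_cos.continuousAt.eventually (lt_mem_nhds (by rw [Real.cos_zero]; norm_num))
  have hsin : ∀ᶠ φ : ℝ in 𝓝 0, |Real.sin φ| < min (C.halfOpening / C.width) (1 / 4) := by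
    have hc : ContinuousAt (fun φ => |Real.sin φ|) 0 := by fun_prop
    refine hc.eventually (gt_mem_nhds ?_)
    simp only [Real.sin_zero, abs_zero]
    positivity
  obtain ⟨η, hη, hland⟩ := exists_landing hr (G := C.width - 2 * C.diskRadius) (by linarith)
    (hlink.and (hcos.and hsin))
  refine ⟨4 * K * (K₀ + K) + C.width, by positivity, min η 1, lt_min hη one_pos,
    fun V hV w hw => ?_⟩
  have hwη : |w| ≤ η * V := hw.trans (by gcongr; exact min_le_left _ _)
  have hw1 : |w| ≤ V := hw.trans (by nlinarith [min_le_right η 1])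
  obtain ⟨φ, ⟨⟨κ, hκ1, hκ2, hφ⟩, hφc, hφs⟩, T₂, hT₂, hT₂K, hland1, hland2⟩ := hland V hV w hwη
  have hκ : 0 < κ := (inv_pos.2 hKpos).trans_le hκ1
  set aL := V * Real.cos φ + w * Real.sin φ with haL
  have haLV : V / 4 ≤ aL := by
    have h1 : |w * Real.sin φ| ≤ V * (1 / 4) := by
      rw [abs_mul]
      exact mul_le_mul hw1 (hφs.le.trans (min_le_right _ _)) (abs_nonneg _) hV.le
    have h2 := neg_le_of_abs_le h1
    nlinarith
  have haL0 : 0 < aL := by linarith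
  -- the initial normal velocity which leads to the normal velocity `aL` on disk `b`
  obtain ⟨T₁, hT₁, hT₁K, h₁⟩ := hφ (aL / κ) (by positivity)
  obtain ⟨T₀, hT₀, hT₀K, h₀⟩ := h₀ (aL / κ) (by positivity) 0 (by rw [abs_zero]; positivity)
  refine ⟨T₀ + T₁ + T₂, by positivity, ?_, fun s => ?_⟩
  · have hdiv : ∀ x : ℝ, 0 < x → x / (aL / κ) ≤ 4 * K * x / V := by
      intro x hx
      rw [div_div_eq_mul_div, div_le_div_iff₀ haL0 hV]
      calc x * κ * V ≤ x * K * (4 * aL) := by gcongr; linarith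
        _ = _ := by ring
    have e : (4 * K * (K₀ + K) + C.width) / V =
        4 * K * K₀ / V + 4 * K * K / V + C.width / V := by ring
    have : (C.width - 2 * C.diskRadius + C.diskRadius) / V ≤ C.width / V := by
      gcongr
      linarith
    rw [e]
    linarith [hdiv K₀ hK₀, hdiv K hKpos]
  · obtain ⟨p, v, hp, him, hin, ht₀⟩ := h₀ s
    obtain ⟨v₁, v₂, ht₁, hv₁, hv₂⟩ := h₁ (s + T₀)
    have ht₂ := hC.travel_next (D := D) S hbd hV hT₂ (by rw [hland1]; ring) hland2 hφc.le
      (hφs.trans_le (min_le_left _ _)) haL0 (s + T₀ + T₁)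
    refine ⟨p, v, hp, him, hin, ?_⟩
    have h01 := ht₀.trans_rim hC (lt_add_of_pos_right _ hT₀) (lt_add_of_pos_right _ hT₁)
      (show S.cell (S.cell d₀) < d by rw [Side.cell_cell]; exact Fin.lt_def.2 hd) ht₁ (by rw [hv₁]; positivity)
      (by rw [hv₁, inner_facing])
    have h02 := h01.trans_rim hC (by linarith) (lt_add_of_pos_right _ hT₂)
      (by simpa [hD] using hblt) ht₂ (by rw [inner_cis_ang_add]; exact haL0)
      (by rw [hv₂, inner_cis_ang_add, mul_div_cancel₀ _ hκ.ne'])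
    rwa [show s + (T₀ + T₁ + T₂) = s + T₀ + T₁ + T₂ by ring]

end CellShape


namespace CellShape

/-! ### Steering the disks -/

variable {C : CellShape} {N : ℕ} {S : Side}

theorem Driver.not_hits_of_exit_le {f : Driver C N S} {s t : ℝ} (h : f.exit ≤ s) (hst : s < t)
    (ℓ : Fin N) : ¬ f.Hits t ℓ := fun hf => by
  have := hf.2.1
  linarith

theorem Driver.not_hits_of_le_enter {f : Driver C N S} {u t : ℝ} (h : u ≤ f.enter) (htu : t ≤ u)
    (ℓ : Fin N) : ¬ f.Hits t ℓ := fun hf => by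
  have := hf.1
  linarith

/-- With drivers that enter and leave during `(s, u)`, the angular velocities of the disks at depth
less than `d` can be changed at will, the other ones being left unchanged. -/
def Settable (C : CellShape) (N : ℕ) (S : Side) (d : ℕ) : Prop :=
  ∀ s u, s < u → ∀ Ω Ω' : Fin N → ℝ, (∀ ℓ, d ≤ (S.cell ℓ : ℕ) → Ω' ℓ = Ω ℓ) →
    ∃ F : Set (Driver C N S), F.Finite ∧ (∀ f ∈ F, s < f.enter ∧ f.exit < u) ∧
      Steers F s u Ω Ω'

theorem Driver.finite_hits (f : Driver C N S) : {t | ∃ ℓ, f.Hits t ℓ}.Finite := by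
  refine f.isPath.finite.subset ?_
  rintro t ⟨ℓ, h1, h2, h3⟩
  exact ⟨h1, h2, ℓ, h3⟩

/-- A driver which hits only disks at depth less than `d` can be escorted: before each of its
collisions, further drivers give the disk to be hit the angular velocity which the driver needs. -/
theorem Settable.escort {d : ℕ} (hset : Settable C N S d) (hC : C.IsCell) (M : Driver C N S)
    (u : ℝ) (k : ℕ) : ∀ s ≤ u, {t | s < t ∧ t ≤ u ∧ ∃ ℓ, M.Hits t ℓ}.ncard ≤ k →
    (∀ t, s < t → t ≤ u → ∀ ℓ, M.Hits t ℓ → (S.cell ℓ : ℕ) < d) → ∀ Ω : Fin N → ℝ,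
    ∃ F : Set (Driver C N S), F.Finite ∧ (∀ f ∈ F, s < f.enter ∧ f.exit < u) ∧
      ∃ Ω', (∀ ℓ, d ≤ (S.cell ℓ : ℕ) → Ω' ℓ = Ω ℓ) ∧ Steers (insert M F) s u Ω Ω' := by
  have hfin : ∀ s, {t | s < t ∧ t ≤ u ∧ ∃ ℓ, M.Hits t ℓ}.Finite := fun s =>
    M.finite_hits.subset fun t ht => ht.2.2
  induction k with
  | zero =>
    intro s hsu hcard hdepth Ω
    have hempty := (Set.ncard_eq_zero (hfin s)).1 (Nat.le_zero.1 hcard)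
    refine ⟨∅, Set.finite_empty, by simp, Ω, fun _ _ => rfl, Steers.idle Ω ?_⟩
    intro f hf t h1 h2 ℓ hℓ
    rw [insert_empty_eq, Set.mem_singleton_iff] at hf
    subst hf
    exact Set.eq_empty_iff_forall_notMem.1 hempty t ⟨h1, h2, ℓ, hℓ⟩
  | succ k ih =>
    intro s hsu hcard hdepth Ω
    rcases Set.eq_empty_or_nonempty {t | s < t ∧ t ≤ u ∧ ∃ ℓ, M.Hits t ℓ} with hemp | hne
    · exact ih s hsu (by rw [hemp]; simp) hdepth Ω
    -- the first collision
    obtain ⟨t₁, ⟨hst, htu, ℓ₁, hℓ₁⟩, hmin⟩ := Set.exists_min_image _ id (hfin s) hne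
    have hfirst : ∀ t, s < t → t < t₁ → ∀ ℓ, ¬ M.Hits t ℓ := fun t h1 h2 ℓ hℓ =>
      absurd (hmin t ⟨h1, h2.le.trans htu, ℓ, hℓ⟩) (not_le.2 h2)
    set m := (s + t₁) / 2 with hm
    have hsm : s < m := by linarith
    have hmt : m < t₁ := by linarith
    set Ω₁ := Function.update Ω ℓ₁
      (inner ℝ (C.diskTangent ℓ₁ (M.motion.pos t₁)) (M.motion.vel t₁)) with hΩ₁
    have hd₁ := hdepth t₁ hst htu ℓ₁ hℓ₁
    have hne₁ : ∀ ℓ, d ≤ (S.cell ℓ : ℕ) → ℓ ≠ ℓ₁ := by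
      rintro ℓ hℓ rfl
      omega
    obtain ⟨F₁, hF₁, hF₁', hst₁⟩ := hset s m hsm Ω Ω₁ fun ℓ hℓ => by
      rw [hΩ₁, Function.update_of_ne (hne₁ ℓ hℓ)]
    have hsingle := Steers.single (s := m) (u := t₁) hmt (Ω := Ω₁) hℓ₁
      (fun ℓ' h' => hC.eq_of_onDisk hℓ₁.2.2 h'.2.2)
      (fun t h1 h2 => hfirst t (hsm.trans h1) h2) (by rw [hΩ₁, Function.update_self])
    set Ω₂ := Function.update Ω₁ ℓ₁
      (inner ℝ (C.diskTangent ℓ₁ (M.motion.pos t₁)) (M.motion.velPre t₁)) with hΩ₂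
    obtain ⟨F₂, hF₂, hF₂', Ω', hΩ', hst₂⟩ := ih t₁ htu (by
      refine Nat.le_of_lt_succ (lt_of_lt_of_le (Set.ncard_lt_ncard ?_ (hfin s)) hcard)
      refine ⟨fun t ht => ⟨hst.trans ht.1, ht.2⟩, fun h => ?_⟩
      exact lt_irrefl t₁ (h ⟨hst, htu, ℓ₁, hℓ₁⟩).1)
      (fun t h1 => hdepth t (hst.trans h1)) Ω₂
    refine ⟨F₁ ∪ F₂, hF₁.union hF₂, ?_, Ω', ?_, ?_⟩
    · rintro f (hf | hf)
      · exact ⟨(hF₁' f hf).1, by linarith [(hF₁' f hf).2]⟩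
      · exact ⟨by linarith [(hF₂' f hf).1], (hF₂' f hf).2⟩
    · intro ℓ hℓ
      rw [hΩ' ℓ hℓ, hΩ₂, Function.update_of_ne (hne₁ ℓ hℓ), hΩ₁,
        Function.update_of_ne (hne₁ ℓ hℓ)]
    · refine Steers.trans hst.le htu (Steers.trans hsm.le hmt.le (hst₁.mono ?_ ?_)
        (hsingle.mono ?_ ?_)) (hst₂.mono ?_ ?_)
      · exact fun f hf => Or.inr (Or.inl hf)
      · rintro f (rfl | hf | hf) hfn t h1 h2 ℓ
        · exact hfirst t h1 (by linarith) ℓ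
        · exact (hfn hf).elim
        · exact f.not_hits_of_le_enter (hF₂' f hf).1.le (by linarith) ℓ
      · rintro f rfl
        exact Or.inl rfl
      · rintro f (rfl | hf | hf) hfn t h1 h2 ℓ
        · exact (hfn rfl).elim
        · exact f.not_hits_of_exit_le (hF₁' f hf).2.le h1 ℓ
        · exact f.not_hits_of_le_enter (hF₂' f hf).1.le h2 ℓ
      · rintro f (rfl | hf)
        · exact Or.inl rfl
        · exact Or.inr (Or.inr hf)
      · rintro f (rfl | hf | hf) hfn t h1 h2 ℓ
        · exact (hfn (Or.inl rfl)).elim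
        · exact f.not_hits_of_exit_le (by linarith [(hF₁' f hf).2]) h1 ℓ
        · exact (hfn (Or.inr hf)).elim

theorem inner_tangent_facing (hC : C.IsCell) (d : Fin N) (V w : ℝ) :
    inner ℝ (C.diskTangent (S.cell d) (C.rim (S.cell d, S.ang + Real.pi)))
      (S.sign * (⟨V, w⟩ : ℂ)) = w := by
  have := S.sign_mul_self
  have hn := diskNormal_rim hC (S.cell d, S.ang + Real.pi)
  simp only at hn
  rw [diskTangent, hn, cis_ang_add_pi]
  simp [Complex.inner]
  linear_combination w * this

/-- The main driver: within an arbitrarily short time it visits disk `d`, to which it brings the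
angular velocity `w`, provided that the angular velocity of that disk has been `o`. All its other
collisions are with disks at smaller depth. -/
theorem exists_visitor (S : Side) (hC : C.IsCell) (hctrl : C.OneControllable) (d : Fin N)
    (w o : ℝ) {s u : ℝ} (hsu : s < u) :
    ∃ (M : Driver C N S) (t : ℝ), s < M.enter ∧ M.exit < u ∧ M.Hits t (S.cell d) ∧
      inner ℝ (C.diskTangent (S.cell d) (M.motion.pos t)) (M.motion.velPre t) = w ∧
      inner ℝ (C.diskTangent (S.cell d) (M.motion.pos t)) (M.motion.vel t) = o ∧
      ∀ t' ≠ t, ∀ ℓ, M.Hits t' ℓ → S.cell ℓ < d := by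
  obtain ⟨K, hK, η, hη, h⟩ := hC.approach S hctrl d
  set V := 4 * K / (u - s) + (|w| + |o|) / η with hVdef
  have hus : 0 < u - s := by linarith
  have hV : 0 < V := by positivity
  have hKV : K / V ≤ (u - s) / 4 := by
    rw [div_le_iff₀ hV]
    have : (u - s) / 4 * (4 * K / (u - s)) = K := by field_simp
    have h2 : 0 ≤ (u - s) / 4 * ((|w| + |o|) / η) := by positivity
    rw [hVdef, mul_add]
    linarith
  have hηV : |w| + |o| ≤ η * V := by
    have : η * ((|w| + |o|) / η) = |w| + |o| := by field_simp
    have h2 : 0 ≤ η * (4 * K / (u - s)) := by positivity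
    rw [hVdef, mul_add]
    linarith
  obtain ⟨T, hT, hTK, h₁⟩ := h V hV w (by linarith [abs_nonneg o])
  obtain ⟨T', hT', hTK', h₂⟩ := h V hV (-o) (by rw [abs_neg]; linarith [abs_nonneg w])
  set a := s + (u - s) / 4 with ha
  obtain ⟨p, v, hp, hpim, hv, γ₁, hγ₁, e1, e2, e3, e4⟩ := h₁ a
  obtain ⟨q, v', hq, hqim, -, hback⟩ := h₂ (a + T)
  obtain ⟨γ₂, hγ₂, f1, f2, f3, f4⟩ := hback.reverse
  have f2' : γ₂.vel (a + T) = S.sign * (⟨-V, o⟩ : ℂ) := by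
    rw [f2]
    apply Complex.ext <;> simp
  have hd := onDisk_rim hC (S.cell d, S.ang + Real.pi)
  have hn := diskNormal_rim hC (S.cell d, S.ang + Real.pi)
  have h1 : a < a + T := by linarith
  have h2 : a + T < a + T + T' := by linarith
  have hpath : C.IsPath (fun _ : Fin N => True) (γ₁.glue γ₂ (a + T)) a (a + T + T') := by
    refine (hγ₁.mono fun _ _ => trivial).glue (hγ₂.mono fun _ _ => trivial) (e3.trans f1.symm) ?_
      fun _ _ => trivial
    rw [f1]
    refine hC.passes_disk (S.cell d) hd ?_ ?_
    · rw [hn, e4, inner_facing]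
      linarith
    · rw [hn, e4, f2', inner_facing, inner_facing]
  have hstart : (γ₁.glue γ₂ (a + T)).pos a = p ∧ (γ₁.glue γ₂ (a + T)).vel a = v := by
    simp [Motion.glue, hT, e1, e2]
  have hend : (γ₁.glue γ₂ (a + T)).pos (a + T + T') = q := by
    simp [Motion.glue, hT'.le.not_gt, f3]
  refine ⟨⟨a, a + T + T', γ₁.glue γ₂ (a + T), h1.trans h2, hpath, by rwa [hstart.1],
    by rwa [hstart.1], by rwa [hstart.2], by rwa [hend], by rwa [hend]⟩, a + T, ?_, ?_,
    ⟨h1, h2, ?_⟩, ?_, ?_, ?_⟩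
  · show s < a
    linarith
  · show a + T + T' < u
    linarith
  · simpa [Motion.glue, f1] using hd
  · simp only [Motion.glue, lt_irrefl, if_false, le_refl, if_true, f1, e4]
    exact inner_tangent_facing hC d V w
  · simp only [Motion.glue, lt_irrefl, if_false, f1, f2']
    exact inner_tangent_facing hC d (-V) o
  · intro t' ht' ℓ hℓ
    have b1 : a < t' := hℓ.1
    have b2 : t' < a + T + T' := hℓ.2.1
    have b3 := hℓ.2.2
    rcases lt_or_gt_of_ne ht' with hlt | hgt
    · exact hγ₁.hits t' b1 hlt ℓ (by simpa [Motion.glue, hlt] using b3)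
    · exact hγ₂.hits t' hgt b2 ℓ (by simpa [Motion.glue, hgt.not_gt] using b3)

theorem Settable.succ {d : ℕ} (hset : Settable C N S d) (hC : C.IsCell)
    (hctrl : C.OneControllable) (hd : d < N) : Settable C N S (d + 1) := by
  intro s u hsu Ω Ω' hΩ
  set L := S.cell ⟨d, hd⟩ with hL
  have hLd : ∀ ℓ, (S.cell ℓ : ℕ) = d → ℓ = L := fun ℓ hℓ => by
    rw [hL, ← S.cell_cell ℓ]
    exact congrArg S.cell (Fin.ext hℓ)
  have hdL : d ≤ (S.cell L : ℕ) := by simp [hL]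
  set m := (s + u) / 2 with hm
  obtain ⟨M, t, hMs, hMm, hMt, hw, ho, hlow⟩ := exists_visitor S hC hctrl ⟨d, hd⟩ (Ω' L) (Ω L)
    (by linarith : s < m)
  have hst : s < t := hMs.trans hMt.1
  have htm : t < m := hMt.2.1.trans hMm
  obtain ⟨ε, hε, hεt⟩ : ∃ ε > 0, ∀ t', t - ε ≤ t' → t' < t → ∀ ℓ, ¬ M.Hits t' ℓ := by
    have hfin : ({t' | ∃ ℓ, M.Hits t' ℓ} \ {t}).Finite := M.finite_hits.sdiff
    obtain ⟨ε, hε, h⟩ := Metric.mem_nhds_iff.1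
      (hfin.isClosed.isOpen_compl.mem_nhds (fun h => h.2 rfl : t ∈ _ᶜ))
    refine ⟨ε / 2, by linarith, fun t' h1 h2 ℓ hℓ => ?_⟩
    exact h (show t' ∈ Metric.ball t ε by
      rw [Metric.mem_ball, Real.dist_eq, abs_lt]; constructor <;> linarith) ⟨⟨ℓ, hℓ⟩, h2.ne⟩
  set b := max ((s + t) / 2) (t - ε) with hb
  have hsb : s < b := lt_of_lt_of_le (by linarith) (le_max_left _ _)
  have hbt : b < t := max_lt (by linarith) (by linarith)
  -- the driver is escorted to disk `L`, hits it, and is escorted back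
  obtain ⟨F₁, hF₁, hF₁', Ω₁, hΩ₁, hst₁⟩ := hset.escort hC M b _ s hsb.le le_rfl
    (fun t' _ h2 ℓ hℓ => Fin.lt_def.1 (hlow t' (by linarith : t' < t).ne ℓ hℓ)) Ω
  have hsingle := Steers.single hbt (Ω := Ω₁) hMt (fun ℓ' h' => hC.eq_of_onDisk hMt.2.2 h'.2.2)
    (fun t' h1 h2 => hεt t' ((le_max_right _ _).trans h1.le) h2) (by rw [hΩ₁ L hdL, ho])
  rw [hw] at hsingle
  obtain ⟨F₂, hF₂, hF₂', Ω₂, hΩ₂, hst₂⟩ := hset.escort hC M m _ t htm.le le_rfl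
    (fun t' h1 _ ℓ hℓ => Fin.lt_def.1 (hlow t' h1.ne' ℓ hℓ)) (Function.update Ω₁ L (Ω' L))
  -- the other disks are reset
  obtain ⟨F₃, hF₃, hF₃', hst₃⟩ := hset m u (by linarith) Ω₂ Ω' fun ℓ hℓ => by
    rw [hΩ₂ ℓ hℓ]
    rcases hℓ.eq_or_lt with h | h
    · rw [hLd ℓ h.symm, Function.update_self]
    · have hne : ℓ ≠ L := by
        rintro rfl
        simp [hL] at h
      rw [Function.update_of_ne hne, hΩ₁ ℓ hℓ, hΩ ℓ h]
  refine ⟨insert M (F₁ ∪ F₂ ∪ F₃), ((hF₁.union hF₂).union hF₃).insert M, ?_, ?_⟩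
  · rintro f (rfl | (hf | hf) | hf)
    · exact ⟨hMs, by linarith⟩
    · exact ⟨(hF₁' f hf).1, by linarith [(hF₁' f hf).2]⟩
    · exact ⟨by linarith [(hF₂' f hf).1], by linarith [(hF₂' f hf).2]⟩
    · exact ⟨by linarith [(hF₃' f hf).1], (hF₃' f hf).2⟩
  · refine Steers.trans (by linarith : s ≤ m) (by linarith) (Steers.trans hst.le htm.le
      (Steers.trans hsb.le hbt.le (hst₁.mono ?_ ?_) (hsingle.mono ?_ ?_)) (hst₂.mono ?_ ?_))
      (hst₃.mono ?_ ?_)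
    · rintro f (rfl | hf)
      · exact Or.inl rfl
      · exact Or.inr (Or.inl (Or.inl hf))
    · rintro f (rfl | (hf | hf) | hf) hfn t' h1 h2 ℓ
      · exact (hfn (Or.inl rfl)).elim
      · exact (hfn (Or.inr hf)).elim
      · exact f.not_hits_of_le_enter (hF₂' f hf).1.le (by linarith) ℓ
      · exact f.not_hits_of_le_enter (hF₃' f hf).1.le (by linarith) ℓ
    · rintro f rfl
      exact Or.inl rfl
    · rintro f (rfl | (hf | hf) | hf) hfn t' h1 h2 ℓ
      · exact (hfn rfl).elim
      · exact f.not_hits_of_exit_le (hF₁' f hf).2.le h1 ℓ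
      · exact f.not_hits_of_le_enter (hF₂' f hf).1.le h2 ℓ
      · exact f.not_hits_of_le_enter (hF₃' f hf).1.le (by linarith) ℓ
    · rintro f (rfl | hf)
      · exact Or.inl rfl
      · exact Or.inr (Or.inl (Or.inr hf))
    · rintro f (rfl | (hf | hf) | hf) hfn t' h1 h2 ℓ
      · exact (hfn (Or.inl rfl)).elim
      · exact f.not_hits_of_exit_le (by linarith [(hF₁' f hf).2]) h1 ℓ
      · exact (hfn (Or.inr hf)).elim
      · exact f.not_hits_of_le_enter (hF₃' f hf).1.le h2 ℓ
    · exact fun f hf => Or.inr (Or.inr hf)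
    · rintro f (rfl | (hf | hf) | hf) hfn t' h1 h2 ℓ
      · exact f.not_hits_of_exit_le hMm.le h1 ℓ
      · exact f.not_hits_of_exit_le (by linarith [(hF₁' f hf).2]) h1 ℓ
      · exact f.not_hits_of_exit_le (hF₂' f hf).2.le h1 ℓ
      · exact (hfn hf).elim

theorem settable (hC : C.IsCell) (hctrl : C.OneControllable) (S : Side) :
    ∀ d ≤ N, Settable C N S d := by
  intro d
  induction d with
  | zero =>
    intro _ s u _ Ω Ω' h
    obtain rfl : Ω' = Ω := funext fun ℓ => h ℓ (Nat.zero_le _)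
    exact ⟨∅, Set.finite_empty, by simp, Steers.idle _ (by simp)⟩
  | succ d ih => exact fun hd => (ih (by omega)).succ hC hctrl hd

/-! ### The evolution of the system -/

/-- The decomposition of a vector along a unit vector and its clockwise rotation. -/
theorem eq_inner_smul_add {n : ℂ} (hn : ‖n‖ = 1) (v : ℂ) :
    v = inner ℝ n v • n + inner ℝ (-Complex.I * n) v • (-Complex.I * n) := by
  have h : n.re ^ 2 + n.im ^ 2 = 1 := by
    have := Complex.normSq_eq_norm_sq n
    rw [Complex.normSq_apply, hn] at this
    linarith
  apply Complex.ext <;> simp [Complex.inner]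
  · linear_combination -v.re * h
  · linear_combination -v.im * h

end CellShape


theorem proposition2 (C : CellShape) (hC : C.IsCell) (hctrl : C.OneControllable)
    (N n : ℕ) (ξ : ChainState N n) (τ : ℝ)
    (E₀ : Evolution C N ξ Injection.none τ)
    (hE₀ : ∀ p t, 0 < t → t < E₀.exitTime p → t < τ →
      ∀ ℓ : Fin N, ¬ C.OnDisk ℓ (E₀.pos p t))
    (j : Fin N) (ω : ℝ) (δ : ℝ) (hδ : 0 < δ) (hδτ : δ < τ) (S : Side) :
    ∃ (m : ℕ) (I : Injection m) (E : Evolution C N ξ I τ),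
      I.IsFrom C N S ∧
      (∀ i, 0 ≤ I.time i ∧ I.time i < δ) ∧
      E.spin j δ = ω ∧
      (∀ ℓ, ℓ ≠ j → E.spin ℓ δ = ξ.spin ℓ) ∧
      (∀ i, E.exitTime (Sum.inr i) ≤ δ ∧
        E.pos (Sum.inr i) (E.exitTime (Sum.inr i)) ∈ C.bath N S) := by
  obtain ⟨F, hF, hFδ, Ω, ΩPre, hΩ, hΩ0, hΩδ⟩ := CellShape.settable hC hctrl S N le_rfl 0 δ hδ
    ξ.spin (Function.update ξ.spin j ω) fun ℓ hℓ => absurd (S.cell ℓ).2 (not_lt.2 hℓ)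
  -- after time `δ` nothing happens to the disks
  have hΩ' := hΩ.glue (CellShape.IsSteering.idle (s := δ) (u := τ) (Function.update ξ.spin j ω)
    fun f hf t h1 _ ℓ => f.not_hits_of_exit_le (hFδ f hf).2.le h1 ℓ) hΩδ
  set Θ : ℝ → Fin N → ℝ := fun x => if x ≤ δ then Ω x else Function.update ξ.spin j ω with hΘ
  set ΘPre : ℝ → Fin N → ℝ := fun x => if x ≤ δ then ΩPre x else Function.update ξ.spin j ω
  have hΘ0 : Θ 0 = ξ.spin := by simp [hΘ, hδ.le, hΩ0]
  have hΘδ : Θ δ = Function.update ξ.spin j ω := by simp [hΘ, hΩδ]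
  clear_value Θ ΘPre
  have := hF.to_subtype
  obtain ⟨m, ⟨e⟩⟩ := Finite.exists_equiv_fin F
  set f : Fin m → CellShape.Driver C N S := fun i => (e.symm i : CellShape.Driver C N S) with hf
  have hfF : ∀ i, f i ∈ F := fun i => (e.symm i).2
  have hfinj : Function.Injective f := Subtype.val_injective.comp e.symm.injective
  have hN : 0 < N := j.pos
  have hbath : ∀ {S' : Side} {p : ℂ}, p ∈ C.bath N S' → |p.im| < C.halfOpening →
      ∀ ℓ : Fin N, ¬ C.OnCorner ℓ p := fun hp him ℓ => by
    obtain ⟨k, hk⟩ := CellShape.IsCell.bath_re hp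
    exact hC.not_corner_of_opening hk him ℓ
  refine ⟨m, ⟨fun i => (f i).enter, fun i => (f i).motion.pos (f i).enter,
    fun i => (f i).motion.vel (f i).enter⟩,
    { pos := Sum.elim (fun p => E₀.pos (Sum.inl p)) fun i => (f i).motion.pos
      vel := Sum.elim (fun p => E₀.vel (Sum.inl p)) fun i => (f i).motion.vel
      velPre := Sum.elim (fun p => E₀.velPre (Sum.inl p)) fun i => (f i).motion.velPre
      exitTime := Sum.elim (fun p => E₀.exitTime (Sum.inl p)) fun i => (f i).exit
      angle := fun ℓ t => ξ.angle ℓ + ((∫ u in (0 : ℝ)..t, Θ u ℓ : ℝ) : Real.Angle)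
      spin := fun ℓ t => Θ t ℓ
      spinPre := fun ℓ t => ΘPre t ℓ
      enter_lt_exit := ?_
      pos_enter := ?_
      vel_enter := ?_
      spin_zero := fun ℓ => by rw [hΘ0]
      angle_eq := fun ℓ t _ _ => rfl
      pos_mem := ?_
      not_corner := ?_
      not_bath := ?_
      exit_bath := ?_
      move_right := ?_
      spin_right := fun ℓ t h1 h2 => (hΩ'.right t h1 h2).mono fun x hx => by rw [hx]
      move_left := ?_
      spin_left := fun ℓ t h1 h2 => (hΩ'.left t h1 h2.le).mono fun x hx => by rw [hx]
      free := ?_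
      wall := ?_
      disk := ?_
      spin_free := ?_
      not_simultaneous := ?_ }, ?_, ?_, ?_, ?_, ?_⟩
  · rintro (p | i)
    · exact E₀.enter_lt_exit (Sum.inl p)
    · exact (f i).enter_lt_exit
  · rintro (p | i)
    · exact E₀.pos_enter (Sum.inl p)
    · rfl
  · rintro (p | i)
    · exact E₀.vel_enter (Sum.inl p)
    · rfl
  · rintro (p | i) t h1 h2 h3
    · exact E₀.pos_mem (Sum.inl p) t h1 h2 h3
    · rcases (show (f i).enter ≤ t from h1).eq_or_lt with h | h
      · rw [← h]
        exact hC.bath_subset_chain hN (f i).enter_mem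
      · exact ((f i).isPath.law t h h2).mem
  · rintro (p | i) t h1 h2 h3
    · exact E₀.not_corner (Sum.inl p) t h1 h2 h3
    · rcases (show t ≤ (f i).exit from h2).eq_or_lt with h | h
      · rw [h]
        exact hbath (f i).exit_mem (f i).exit_im
      · exact ((f i).isPath.law t h1 h).corner
  · rintro (p | i) t h1 h2 h3
    · exact E₀.not_bath (Sum.inl p) t h1 h2 h3
    · exact ((f i).isPath.law t h1 h2).bath
  · rintro (p | i) h
    · exact E₀.exit_bath (Sum.inl p) h
    · exact ⟨S, (f i).exit_mem⟩
  · rintro (p | i) t h1 h2 h3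
    · exact E₀.move_right (Sum.inl p) t h1 h2 h3
    · exact ((f i).isPath.right t h1 h2).mono fun x hx => ⟨hx.1, hx.2.1⟩
  · rintro (p | i) t h1 h2 h3
    · exact E₀.move_left (Sum.inl p) t h1 h2 h3
    · exact ((f i).isPath.left t h1 h2).mono fun x hx => ⟨hx.1, hx.2.1⟩
  · rintro (p | i) t h1 h2 h3
    · exact E₀.free (Sum.inl p) t h1 h2 h3
    · exact ((f i).isPath.law t h1 h2).free
  · rintro (p | i) t h1 h2 h3
    · exact E₀.wall (Sum.inl p) t h1 h2 h3
    · exact ((f i).isPath.law t h1 h2).wall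
  · rintro (p | i) t h1 h2 h3 ℓ hℓ
    · exact (hE₀ (Sum.inl p) t h1 h2 h3 ℓ hℓ).elim
    · have h1' : (f i).enter < t := h1
      have hℓ' : C.OnDisk ℓ ((f i).motion.pos t) := hℓ
      obtain ⟨hne, hnorm⟩ := ((f i).isPath.law t h1 h2).disk ℓ hℓ
      obtain ⟨hpre, hpost⟩ := hΩ'.hit (f i) (hfF i) t (by linarith [(hFδ _ (hfF i)).1]) h3.le ℓ
        ⟨h1, h2, hℓ⟩
      refine ⟨hne, ?_, hpost⟩
      rw [hpre]
      have := CellShape.eq_inner_smul_add (CellShape.norm_diskNormal hC.diskRadius_pos hℓ')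
        ((f i).motion.vel t)
      rw [hnorm] at this
      exact this
  · intro ℓ t h1 h2 h
    exact hΩ'.free t h1 h2.le ℓ fun g hg hh => by
      have := h (Sum.inr (e ⟨g, hg⟩))
      simp only [enterTime, Sum.elim_inr, hf, Equiv.symm_apply_apply] at this
      exact this hh.1 hh.2.1 hh.2.2
  · rintro (p | i) (p' | i') t h1 h2 h3 h4 h5 ℓ hℓ hℓ'
    · exact (hE₀ (Sum.inl p) t h1 h2 h5 ℓ hℓ).elim
    · exact (hE₀ (Sum.inl p) t h1 h2 h5 ℓ hℓ).elim
    · exact (hE₀ (Sum.inl p') t h3 h4 h5 ℓ hℓ').elim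
    · have h1' : (f i).enter < t := h1
      exact congrArg Sum.inr (hfinj (hΩ'.inj (f i) (hfF i) (f i') (hfF i') t
        (by linarith [(hFδ _ (hfF i)).1]) h5.le ℓ ⟨h1, h2, hℓ⟩ ⟨h3, h4, hℓ'⟩))
  · exact fun i => ⟨(f i).enter_mem, (f i).enter_im, (f i).inward⟩
  · intro i
    have := hFδ _ (hfF i)
    have h2 := (f i).enter_lt_exit
    exact ⟨this.1.le, by show (f i).enter < δ; linarith⟩
  · show Θ δ j = ω
    rw [hΘδ, Function.update_self]
  · intro ℓ hℓ
    show Θ δ ℓ = ξ.spin ℓ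
    rw [hΘδ, Function.update_of_ne hℓ]
  · exact fun i => ⟨(hFδ _ (hfF i)).2.le, (f i).exit_mem⟩
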